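/- **Setting.** Let $D\subset S^2$ be a connected oriented link diagram with at least one crossing, in which every component of the link $L$ passes at least once over and at least once under a crossing. Segments are the edges of the underlying 4-valent graph; regions are its faces. Draw each crossing with both strands running from left to right, with incoming segments $1$ (upper left), $2$ (lower left) and outgoing segments $2'$ (upper right), $1'$ (lower right), strand $i$ running from $i$ to $i'$; the over-strand is strand $1$ at a positive and strand $2$ at a negative crossing. The corners are $N$ (between $1,2'$), $W$ (between $1,2$), $S$ (between $2,1'$), $E$ (between $2',1'$). *Shaping.* A shaping assigns to each segment a triple $\chi=(a,b,m)\in(\mathbb C\setminus\{0\})^3$ such that $(\chi_{2'},\chi_{1'})=B(\chi_1,\chi_2)$ at positive crossings and $(\chi_{2'},\chi_{1'})=B^{-1}(\chi_1,\chi_2)$ at negative crossings, where $B(\chi_1,\chi_2)=(\chi_{2'},\chi_{1'})$ is the partially defined map $a_{1'}=a_1A^{-1}$, $a_{2'}=a_2A$, $A=1-\frac{m_1b_1}{b_2}\bigl(1-\frac{a_1}{m_1}\bigr)\bigl(1-\frac1{m_2a_2}\bigr)$, $b_{1'}=\frac{m_2b_2}{m_1}\bigl(1-m_2a_2(1-\frac{b_2}{m_1b_1})\bigr)^{-1}$,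 $b_{2'}=b_1\bigl(1-\frac{m_1}{a_1}(1-\frac{b_2}{m_1b_1})\bigr)$, $m_{1'}=m_1$, $m_{2'}=m_2$. A crossing is pinched if $b_2=m_1b_1$ or $m_2b_2=m_1b_{1'}$ or $b_{2'}=b_1$ or $m_2b_{2'}=b_{1'}$. *Algebraic holonomy.* $\Pi_1(D)$ is the groupoid whose objects are the regions, generated by two morphisms $x_s^{+},x_s^{-}$ (passing above, below $s$) from the left to the right region of each segment $s$, with the relations $x_1^\pm x_2^\pm=x_{2'}^\pm x_{1'}^\pm$ at every crossing, $x_1^-x_2^+=x_{2'}^+x_{1'}^-$ at positive crossings and $x_1^+x_2^-=x_{2'}^-x_{1'}^+$ at negative crossings. Words are read from left to right. The algebraic holonomy $\rho$ is the representation of $\Pi_1(D)$ by invertible $2\times2$ matrices with $$\rho(x_s^+)=\begin{bmatrix}a_s&0\\(a_s-1/m_s)/b_s&1\end{bmatrix},\qquad \rho(x_s^-)=\begin{bmatrix}1&(a_s-m_s)b_s\\0&a_s\end{bmatrix}.$$ *Four-term triangulation.* Each corner of each crossing carries an ideal tetrahedron with vertices $P_1,P_2,P_-,P_+$, placed on $\widehat{\mathbb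 C}=\mathbb C\cup\{\infty\}$ at $P_-=0$, $P_+=\infty$ and $$\begin{array}{c|cc}&P_1&P_2\\\hline N&-1/b_1&-1/b_{2'}\\W&-1/(m_1b_1)&-1/b_2\\S&-1/(m_1b_{1'})&-1/(m_2b_2)\\E&-1/b_{1'}&-1/(m_2b_{2'})\end{array}$$ The gluings preserve $P_-$ and $P_+$. At each crossing, two tetrahedra separated by a segment of the under-strand are glued along their faces $P_1P_2P_+$, and two separated by a segment of the over-strand along their faces $P_1P_2P_-$. The face with vertices $P_-$, $P_+$ and the vertex on a segment's strand is glued to the corresponding face at the other end and on the same side of that segment. Let $\Pi_1(T)$ be the fundamental groupoid of the resulting ideal triangulation $T$ with the tetrahedra as base points: it is generated by the passages through faces, subject to the relations that passing through a face and back is trivial and that every full turn around an edge is trivial. A *face map* for a passage through a face is an element of $\mathrm{PSL}_2(\mathbb C)$ carrying the positions of the three vertices of the face to the positions of the vertices of the neighbouring tetrahedron to which they are glued, where $\mathrm{PSL}_2(\mathbb C)$ acts on the right by $z\cdot\begin{bmatrix}a&b\\c&d\end{bmatrix}=\frac{az+c}{bz+d}$. **Theorem.** For every shaping of such a diagram $D$: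 1. Sending a tetrahedron to its region, a passage through a face $P_1P_2P_+$ (resp. $P_1P_2P_-$) to $(x_s^{+})^{\pm1}$ (resp. $(x_s^{-})^{\pm1}$), where $s$ is the segment crossed and the exponent is $+1$ if it is crossed from left to right and $-1$ otherwise, and a passage through any other face to an identity, defines an equivalence of groupoids $\Phi:\Pi_1(T)\to\Pi_1(D)$. 2. The algebraic holonomy $\rho$ is well defined on $\Pi_1(D)$. 3. There is a representation $\mathrm{hol}:\Pi_1(T)\to\mathrm{PSL}_2(\mathbb C)$ whose value on every passage through a face is a face map; at a tetrahedron of a crossing that is not pinched, it is the only face map. In particular, if no crossing is pinched, $\mathrm{hol}$ is the representation generated by the face maps. 4. The two holonomies agree: for every morphism $\gamma$ of $\Pi_1(T)$, $\mathrm{hol}(\gamma)$ is the class of $\rho(\Phi(\gamma))$ in $\mathrm{PGL}_2(\mathbb C)=\mathrm{PSL}_2(\mathbb C)$. -/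

import Mathlib

open CategoryTheory Matrix
open scoped MatrixGroups

/-! ## Oriented link diagrams

A crossing is drawn with both strands running from left to right.  The incoming segments are `1`
(upper left) and `2` (lower left), the outgoing segments are `2'` (upper right) and `1'` (lower
right); strand one runs from `1` to `1'` and strand two from `2` to `2'`.  The four corners are
`N` (between `1` and `2'`), `W` (between `1` and `2`), `S` (between `2` and `1'`) and `E`
(between `2'` and `1'`). -/

/-- The two strands at a crossing. -/
inductive Strand where
  | one
  | two
  deriving DecidableEq

/-- The other strand. -/
def Strand.other : Strand → Strand
  | .one => .two
  | .two => .one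

/-- The four corners at a crossing. -/
inductive Side where
  | N
  | W
  | S
  | E

/-- Whether strand `k` touches the corner by its incoming segment (otherwise by the outgoing). -/
def Side.incoming : Side → Strand → Bool
  | .N, .one => true
  | .N, .two => false
  | .W, .one => true
  | .W, .two => true
  | .S, .one => false
  | .S, .two => true
  | .E, .one => false
  | .E, .two => false

/-- Whether the corner lies to the left of strand `k`. -/
def Side.isLeft : Side → Strand → Bool
  | .N, .one => true
  | .N, .two => true
  | .W, .one => false
  | .W, .two => true
  | .S, .one => false
  | .S, .two => false
  | .E, .one => true
  | .E, .two => false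

/-- The corner on the left (`true`) or right (`false`) of the incoming segment of a strand. -/
def Strand.inSide : Strand → Bool → Side
  | .one, true => .N
  | .one, false => .W
  | .two, true => .W
  | .two, false => .S

/-- The corner on the left (`true`) or right (`false`) of the outgoing segment of a strand. -/
def Strand.outSide : Strand → Bool → Side
  | .one, true => .E
  | .one, false => .S
  | .two, true => .N
  | .two, false => .E

/-- The corner reached from a given corner by crossing the adjacent segment of a strand. -/
def Side.across : Side → Strand → Side
  | .N, .one => .W
  | .W, .one => .N
  | .S, .one => .E
  | .E, .one => .S
  | .N, .two => .E
  | .E, .two => .N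
  | .W, .two => .S
  | .S, .two => .W

/-- Signed oriented crossings joined by segments: a decorated oriented 4-valent graph with a
cyclic order (a ribbon structure) at each vertex.  Each segment leaves one crossing as the
outgoing end of a strand (`tail`) and enters one crossing as the incoming end of a strand
(`head`). -/
structure CrossingGraph where
  Crossing : Type
  Segment : Type
  finiteCrossing : Finite Crossing
  positive : Crossing → Bool
  tail : Segment ≃ Crossing × Strand
  head : Segment ≃ Crossing × Strand

namespace CrossingGraph

variable (G : CrossingGraph)

/-- A corner of the diagram: a crossing and one of the sides `N, W, S, E`. -/
structure Corner where
  crossing : G.Crossing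
  side : Side

/-- The corner at the tail of `s`, to its left (`true`) or right (`false`). -/
def tailCorner (s : G.Segment) (left : Bool) : G.Corner :=
  ⟨(G.tail s).1, (G.tail s).2.outSide left⟩

/-- The corner at the head of `s`, to its left (`true`) or right (`false`). -/
def headCorner (s : G.Segment) (left : Bool) : G.Corner :=
  ⟨(G.head s).1, (G.head s).2.inSide left⟩

/-- Corners at the two ends of a segment and on the same side of it. -/
inductive SameSide : G.Corner → G.Corner → Prop
  | mk (s : G.Segment) (left : Bool) : SameSide (G.tailCorner s left) (G.headCorner s left)

/-- Regions: the faces of the ribbon graph, as classes of corners. -/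
def Region : Type := Quot G.SameSide

variable {G}

/-- The region containing a corner. -/
def Corner.region (t : G.Corner) : G.Region := Quot.mk _ t

variable (G)

/-- The region to the left (`true`) or right (`false`) of a segment. -/
def segmentRegion (s : G.Segment) (left : Bool) : G.Region := (G.tailCorner s left).region

/-- Two crossings are adjacent if a segment runs from the first to the second. -/
def Adjacent (c c' : G.Crossing) : Prop := ∃ s, (G.tail s).1 = c ∧ (G.head s).1 = c'

/-- The over-strand: strand one at a positive crossing, strand two at a negative one. -/
def overStrand (c : G.Crossing) : Strand := if G.positive c then .one else .two

/-- The under-strand. -/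
def underStrand (c : G.Crossing) : Strand := (G.overStrand c).other

/-- The segment that follows `s` when one traverses the link. -/
def nextSegment : Equiv.Perm G.Segment := G.head.trans G.tail.symm

/-- The incoming segment `1`. -/
def s₁ (c : G.Crossing) : G.Segment := G.head.symm (c, .one)
/-- The incoming segment `2`. -/
def s₂ (c : G.Crossing) : G.Segment := G.head.symm (c, .two)
/-- The outgoing segment `1'`. -/
def s₁' (c : G.Crossing) : G.Segment := G.tail.symm (c, .one)
/-- The outgoing segment `2'`. -/
def s₂' (c : G.Crossing) : G.Segment := G.tail.symm (c, .two)

variable {G}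

/-- The segment of strand `k` that bounds the corner. -/
def Corner.segment (t : G.Corner) (k : Strand) : G.Segment :=
  if t.side.incoming k then G.head.symm (t.crossing, k) else G.tail.symm (t.crossing, k)

/-- The corner across the adjacent segment of strand `k` at the same crossing. -/
def Corner.across (t : G.Corner) (k : Strand) : G.Corner := ⟨t.crossing, t.side.across k⟩

/-- The corner at the other end, and on the same side, of the segment of strand `k` bounding
the corner `t`. -/
def Corner.along (t : G.Corner) (k : Strand) : G.Corner :=
  if t.side.incoming k then G.tailCorner (t.segment k) (t.side.isLeft k)
  else G.headCorner (t.segment k) (t.side.isLeft k)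

/-- The strand to which the segment of strand `k` at `t` belongs at its other end. -/
def Corner.alongStrand (t : G.Corner) (k : Strand) : Strand :=
  if t.side.incoming k then (G.tail (t.segment k)).2 else (G.head (t.segment k)).2

theorem headCorner_symm (c : G.Crossing) (k : Strand) (b : Bool) :
    G.headCorner (G.head.symm (c, k)) b = ⟨c, k.inSide b⟩ := by
  simp [headCorner]

theorem tailCorner_symm (c : G.Crossing) (k : Strand) (b : Bool) :
    G.tailCorner (G.tail.symm (c, k)) b = ⟨c, k.outSide b⟩ := by
  simp [tailCorner]

theorem region_headCorner (s : G.Segment) (b : Bool) :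
    (G.headCorner s b).region = G.segmentRegion s b :=
  (Quot.sound (SameSide.mk s b)).symm

theorem Corner.region_eq (t : G.Corner) (k : Strand) :
    G.segmentRegion (t.segment k) (t.side.isLeft k) = t.region := by
  obtain ⟨c, K⟩ := t
  rw [← region_headCorner]
  cases K <;> cases k <;>
    first
    | exact congrArg Corner.region (headCorner_symm c _ _)
    | exact (region_headCorner _ _).trans (congrArg Corner.region (tailCorner_symm c _ _))

theorem Corner.region_along (t : G.Corner) (k : Strand) : t.region = (t.along k).region := by
  rw [← t.region_eq k]
  unfold Corner.along
  split
  · rfl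
  · exact (region_headCorner _ _).symm

theorem Corner.segment_across (t : G.Corner) (k : Strand) :
    (t.across k).segment k = t.segment k := by
  obtain ⟨c, K⟩ := t
  cases K <;> cases k <;> rfl

theorem Corner.isLeft_across (t : G.Corner) (k : Strand) :
    (t.across k).side.isLeft k = !t.side.isLeft k := by
  obtain ⟨c, K⟩ := t
  cases K <;> cases k <;> rfl

theorem Corner.region_across (t : G.Corner) (k : Strand) :
    G.segmentRegion (t.segment k) (!t.side.isLeft k) = (t.across k).region := by
  rw [← (t.across k).region_eq k, segment_across, isLeft_across]

end CrossingGraph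

/-- An oriented link diagram in the 2-sphere: connected, with at least one crossing, and planar
in the sense of Euler's formula. -/
structure LinkDiagram extends CrossingGraph where
  nonempty : Nonempty Crossing
  connected : ∀ c c' : Crossing, Relation.EqvGen toCrossingGraph.Adjacent c c'
  planar : Nat.card Crossing + Nat.card toCrossingGraph.Region = Nat.card Segment + 2

/-- Every link component has at least one over-passage and at least one under-passage, so that
the octahedra at the crossings triangulate the complement of the link (and of one further point
above and one below the diagram). -/
def LinkDiagram.OverAndUnder (D : LinkDiagram) : Prop :=
  ∀ s : D.Segment,
    (∃ s', D.nextSegment.SameCycle s s' ∧ (D.head s').2 = D.overStrand (D.head s').1) ∧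
    (∃ s', D.nextSegment.SameCycle s s' ∧ (D.head s').2 = D.underStrand (D.head s').1)

/-! ## The fundamental groupoid of a diagram -/

namespace LinkDiagram

variable (D : LinkDiagram)

/-- Generators from region `r` to region `r'`: for each segment with `r` on its left and `r'` on
its right, one path `x⁺` above it (`above = true`) and one path `x⁻` below it. -/
structure PathGen (r r' : D.Region) where
  seg : D.Segment
  above : Bool
  left_eq : D.segmentRegion seg true = r
  right_eq : D.segmentRegion seg false = r'

/-- The objects of the fundamental groupoid: regions, as vertices of the quiver of generators. -/
def RegionVertex : Type := D.Region

instance : Quiver D.RegionVertex := ⟨fun r r' => D.PathGen r r'⟩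

/-- The free groupoid on the generators `x⁺`, `x⁻`. -/
abbrev FreePaths : Type := Quiver.FreeGroupoid D.RegionVertex

/-- A region as an object of the free groupoid. -/
def freeObj (r : D.Region) : D.FreePaths := (Quiver.FreeGroupoid.of D.RegionVertex).obj r

/-- The generator of a segment, in the free groupoid. -/
def freeGen {r r' : D.Region} (g : D.PathGen r r') : D.freeObj r ⟶ D.freeObj r' :=
  (Quiver.FreeGroupoid.of D.RegionVertex).map (X := r) (Y := r') g

/-- The generator of segment `1`, from the north to the west region. -/
def x₁ (c : D.Crossing) (above : Bool) :
    D.freeObj (CrossingGraph.Corner.region ⟨c, .N⟩) ⟶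
      D.freeObj (CrossingGraph.Corner.region ⟨c, .W⟩) :=
  D.freeGen ⟨D.s₁ c, above, CrossingGraph.Corner.region_eq ⟨c, .N⟩ .one,
    CrossingGraph.Corner.region_eq ⟨c, .W⟩ .one⟩

/-- The generator of segment `2`, from the west to the south region. -/
def x₂ (c : D.Crossing) (above : Bool) :
    D.freeObj (CrossingGraph.Corner.region ⟨c, .W⟩) ⟶
      D.freeObj (CrossingGraph.Corner.region ⟨c, .S⟩) :=
  D.freeGen ⟨D.s₂ c, above, CrossingGraph.Corner.region_eq ⟨c, .W⟩ .two,
    CrossingGraph.Corner.region_eq ⟨c, .S⟩ .two⟩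

/-- The generator of segment `2'`, from the north to the east region. -/
def x₂' (c : D.Crossing) (above : Bool) :
    D.freeObj (CrossingGraph.Corner.region ⟨c, .N⟩) ⟶
      D.freeObj (CrossingGraph.Corner.region ⟨c, .E⟩) :=
  D.freeGen ⟨D.s₂' c, above, CrossingGraph.Corner.region_eq ⟨c, .N⟩ .two,
    CrossingGraph.Corner.region_eq ⟨c, .E⟩ .two⟩

/-- The generator of segment `1'`, from the east to the south region. -/
def x₁' (c : D.Crossing) (above : Bool) :
    D.freeObj (CrossingGraph.Corner.region ⟨c, .E⟩) ⟶
      D.freeObj (CrossingGraph.Corner.region ⟨c, .S⟩) :=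
  D.freeGen ⟨D.s₁' c, above, CrossingGraph.Corner.region_eq ⟨c, .E⟩ .one,
    CrossingGraph.Corner.region_eq ⟨c, .S⟩ .one⟩

/-- The three relations at each crossing: passing above both strands, below both strands, and
between the two strands. -/
inductive CrossingRel : HomRel D.FreePaths
  | same (c : D.Crossing) (above : Bool) :
      CrossingRel (D.x₁ c above ≫ D.x₂ c above) (D.x₂' c above ≫ D.x₁' c above)
  | between_pos (c : D.Crossing) (h : D.positive c = true) :
      CrossingRel (D.x₁ c false ≫ D.x₂ c true) (D.x₂' c true ≫ D.x₁' c false)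
  | between_neg (c : D.Crossing) (h : D.positive c = false) :
      CrossingRel (D.x₁ c true ≫ D.x₂ c false) (D.x₂' c false ≫ D.x₁' c true)

/-- The fundamental groupoid of the diagram. -/
abbrev PathGroupoid : Type := CategoryTheory.Quotient D.CrossingRel

/-- A region as an object of the fundamental groupoid. -/
def obj (r : D.Region) : D.PathGroupoid :=
  (CategoryTheory.Quotient.functor D.CrossingRel).obj (D.freeObj r)

/-- The path above or below a segment, in the fundamental groupoid. -/
def gen {r r' : D.Region} (g : D.PathGen r r') : D.obj r ⟶ D.obj r' :=
  (CategoryTheory.Quotient.functor D.CrossingRel).map (D.freeGen g)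

/-- The path from the left to the right of a segment, above it (`true`) or below it (`false`). -/
def segmentPath (s : D.Segment) (above : Bool) :
    D.obj (D.segmentRegion s true) ⟶ D.obj (D.segmentRegion s false) :=
  D.gen ⟨s, above, rfl, rfl⟩

/-- The path from a corner across the adjacent segment of strand `k`, above or below it: a
generator or the inverse of a generator, according to the direction of the crossing. -/
noncomputable def crossPath (t : D.Corner) (k : Strand) (above : Bool) :
    D.obj t.region ⟶ D.obj (t.across k).region :=
  if h : t.side.isLeft k = true then
    D.gen ⟨t.segment k, above, by rw [← t.region_eq k, h],
      by rw [← t.region_across k, h]; rfl⟩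
  else
    Groupoid.inv (D.gen ⟨t.segment k, above,
      by rw [← t.region_across k, Bool.eq_false_of_not_eq_true h]; rfl,
      by rw [← t.region_eq k, Bool.eq_false_of_not_eq_true h]⟩)

end LinkDiagram

/-- A representation of a groupoid in a group; words in the groupoid are read from left to
right. -/
structure GroupoidRep (𝒢 : Type) [Groupoid.{0} 𝒢] (G : Type) [Group G] where
  val : ∀ {x y : 𝒢}, (x ⟶ y) → G
  val_id : ∀ x : 𝒢, val (𝟙 x) = 1
  val_comp : ∀ {x y z : 𝒢} (f : x ⟶ y) (g : y ⟶ z), val (f ≫ g) = val f * val g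

/-! ## Shapes, shaped diagrams and their algebraic holonomy -/

/-- A shape: a triple of nonzero complex numbers. -/
structure Shape where
  a : ℂ
  b : ℂ
  m : ℂ
  a_ne : a ≠ 0
  b_ne : b ≠ 0
  m_ne : m ≠ 0

/-- The relation `B(χ₁, χ₂) = (χ₂', χ₁')` for the partially defined braiding `B`.  All entries of
the outputs being nonzero, the quantities that are inverted here are automatically nonzero. -/
structure Braided (χ₁ χ₂ χ₂' χ₁' : Shape) : Prop where
  a₁' : χ₁'.a = χ₁.a *
    (1 - χ₁.m * χ₁.b / χ₂.b * (1 - χ₁.a / χ₁.m) * (1 - 1 / (χ₂.m * χ₂.a)))⁻¹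
  a₂' : χ₂'.a = χ₂.a *
    (1 - χ₁.m * χ₁.b / χ₂.b * (1 - χ₁.a / χ₁.m) * (1 - 1 / (χ₂.m * χ₂.a)))
  b₁' : χ₁'.b = χ₂.m * χ₂.b / χ₁.m *
    (1 - χ₂.m * χ₂.a * (1 - χ₂.b / (χ₁.m * χ₁.b)))⁻¹
  b₂' : χ₂'.b = χ₁.b * (1 - χ₁.m / χ₁.a * (1 - χ₂.b / (χ₁.m * χ₁.b)))
  m₁' : χ₁'.m = χ₁.m
  m₂' : χ₂'.m = χ₂.m

/-- A shaping: `(χ₂', χ₁')` is `B(χ₁, χ₂)` at positive crossings and `B⁻¹(χ₁, χ₂)` at negative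
crossings. -/
structure Shaping (D : LinkDiagram) where
  shape : D.Segment → Shape
  positive_crossing : ∀ c, D.positive c = true →
    Braided (shape (D.s₁ c)) (shape (D.s₂ c)) (shape (D.s₂' c)) (shape (D.s₁' c))
  negative_crossing : ∀ c, D.positive c = false →
    Braided (shape (D.s₂' c)) (shape (D.s₁' c)) (shape (D.s₁ c)) (shape (D.s₂ c))

/-- The matrix of `x⁺` (`true`) or `x⁻` (`false`) at a segment with the given shape. -/
noncomputable def Shape.matrix (χ : Shape) : Bool → Matrix (Fin 2) (Fin 2) ℂ
  | true => !![χ.a, 0; (χ.a - 1 / χ.m) / χ.b, 1]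
  | false => !![1, (χ.a - χ.m) * χ.b; 0, χ.a]

/-- `ρ` is the algebraic holonomy representation of the shaped diagram. -/
def Shaping.IsHolonomy {D : LinkDiagram} (χ : Shaping D)
    (ρ : GroupoidRep D.PathGroupoid (GL (Fin 2) ℂ)) : Prop :=
  ∀ (s : D.Segment) (above : Bool),
    (ρ.val (D.segmentPath s above) : Matrix (Fin 2) (Fin 2) ℂ) = (χ.shape s).matrix above

/-- A crossing is pinched. -/
def Shaping.Pinched {D : LinkDiagram} (χ : Shaping D) (c : D.Crossing) : Prop :=
  (χ.shape (D.s₂ c)).b = (χ.shape (D.s₁ c)).m * (χ.shape (D.s₁ c)).b ∨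
  (χ.shape (D.s₂ c)).m * (χ.shape (D.s₂ c)).b
    = (χ.shape (D.s₁ c)).m * (χ.shape (D.s₁' c)).b ∨
  (χ.shape (D.s₂' c)).b = (χ.shape (D.s₁ c)).b ∨
  (χ.shape (D.s₂ c)).m * (χ.shape (D.s₂' c)).b = (χ.shape (D.s₁' c)).b

/-! ## Glued ideal tetrahedra and their fundamental groupoid -/

/-- The vertices of a tetrahedron: `strand .one` is `P₁`, `strand .two` is `P₂`, `minus` is `P₋`
and `plus` is `P₊`. -/
inductive IdealVertex where
  | strand (k : Strand)
  | minus
  | plus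
  deriving DecidableEq

/-- Tetrahedra glued along faces.  The face opposite to the vertex `v` of `t` is glued to a face
of `nbr t v` by the restriction of `perm t v`, where `perm t v v` is the vertex of `nbr t v`
opposite to the glued face. -/
structure TetGluing where
  Tet : Type
  nbr : Tet → IdealVertex → Tet
  perm : Tet → IdealVertex → Equiv.Perm IdealVertex
  nbr_nbr : ∀ t v, nbr (nbr t v) (perm t v v) = t
  perm_perm : ∀ t v, perm (nbr t v) (perm t v v) = (perm t v)⁻¹

namespace TetGluing

variable (T : TetGluing)

/-- The tetrahedra, as vertices of the dual graph. -/
def Dual : Type := T.Tet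

/-- The faces through which one passes from `t` to `t'`, labeled by the opposite vertex. -/
structure FaceArrow (t t' : T.Tet) where
  vertex : IdealVertex
  nbr_eq : T.nbr t vertex = t'

instance : Quiver T.Dual := ⟨fun t t' => T.FaceArrow t t'⟩

/-- The free groupoid on passages through faces. -/
abbrev FreeDual : Type := Quiver.FreeGroupoid T.Dual

/-- A tetrahedron as an object. -/
def freeObj (t : T.Tet) : T.FreeDual := (Quiver.FreeGroupoid.of T.Dual).obj t

/-- Passage through a face, in the free groupoid. -/
def freeFace {t t' : T.Tet} (e : T.FaceArrow t t') : T.freeObj t ⟶ T.freeObj t' :=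
  (Quiver.FreeGroupoid.of T.Dual).map (X := t) (Y := t') e

/-- An edge of a tetrahedron and a direction of rotation around it: the edge is the one not
containing `out` and `into`, and one leaves the tetrahedron through the face opposite to
`out`. -/
structure Flag where
  tet : T.Tet
  out : IdealVertex
  into : IdealVertex
  ne : out ≠ into

variable {T}

/-- Rotation around an edge to the next tetrahedron. -/
def Flag.next (f : T.Flag) : T.Flag :=
  ⟨T.nbr f.tet f.out, T.perm f.tet f.out f.into, T.perm f.tet f.out f.out,
    fun h => f.ne ((T.perm f.tet f.out).injective h).symm⟩

variable (T)

/-- `EdgePath f g p`: the path `p` rotates around an edge from `f` to `g`. -/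
inductive EdgePath : (f g : T.Flag) → (T.freeObj f.tet ⟶ T.freeObj g.tet) → Prop
  | nil (f : T.Flag) : EdgePath f f (𝟙 _)
  | cons (f g : T.Flag) (p : T.freeObj f.next.tet ⟶ T.freeObj g.tet) (h : EdgePath f.next g p) :
      EdgePath f g (T.freeFace ⟨f.out, rfl⟩ ≫ p)

/-- The relations of the dual 2-complex: passing through a face and back is trivial, and so is a
full turn around an edge. -/
inductive DualRel : HomRel T.FreeDual
  | back (t : T.Tet) (v : IdealVertex) :
      DualRel (T.freeFace ⟨v, rfl⟩ ≫ T.freeFace ⟨T.perm t v v, T.nbr_nbr t v⟩) (𝟙 (T.freeObj t))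
  | edge (f : T.Flag) (p : T.freeObj f.tet ⟶ T.freeObj f.tet) (h : T.EdgePath f f p) :
      DualRel p (𝟙 _)

/-- The fundamental groupoid of the space obtained by gluing the ideal tetrahedra (with the
ideal vertices removed), with the tetrahedra as base points. -/
abbrev FundGroupoid : Type := CategoryTheory.Quotient T.DualRel

/-- A tetrahedron as an object of the fundamental groupoid. -/
def obj (t : T.Tet) : T.FundGroupoid :=
  (CategoryTheory.Quotient.functor T.DualRel).obj (T.freeObj t)

/-- Passage from `t` through the face opposite to `v`. -/
def face (t : T.Tet) (v : IdealVertex) : T.obj t ⟶ T.obj (T.nbr t v) :=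
  (CategoryTheory.Quotient.functor T.DualRel).map (T.freeFace ⟨v, rfl⟩)

end TetGluing

/-! ## Fractional linear transformations and face maps -/

/-- The right action on the Riemann sphere: `z ⬝ [a, b; c, d] = (a z + c) / (b z + d)`. -/
noncomputable def rightMobius (M : Matrix (Fin 2) (Fin 2) ℂ) (z : OnePoint ℂ) : OnePoint ℂ :=
  open scoped Classical in
  z.elim
    (if M 0 1 = 0 then OnePoint.infty else ((M 0 0 / M 0 1 : ℂ) : OnePoint ℂ))
    (fun w => if M 0 1 * w + M 1 1 = 0 then OnePoint.infty
      else (((M 0 0 * w + M 1 0) / (M 0 1 * w + M 1 1) : ℂ) : OnePoint ℂ))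

/-- The element `g` of `PSL₂(ℂ)` carries `z` to `w` under the right action. -/
def Carries (g : PSL(2, ℂ)) (z w : OnePoint ℂ) : Prop :=
  ∃ A : SL(2, ℂ), (QuotientGroup.mk A : PSL(2, ℂ)) = g ∧
    rightMobius (A : Matrix (Fin 2) (Fin 2) ℂ) z = w

/-- The class of the invertible matrix `M` in `PGL₂(ℂ) = PSL₂(ℂ)` is `g`. -/
def IsClassOf (M : GL (Fin 2) ℂ) (g : PSL(2, ℂ)) : Prop :=
  ∃ (A : SL(2, ℂ)) (c : ℂ), (QuotientGroup.mk A : PSL(2, ℂ)) = g ∧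
    (M : Matrix (Fin 2) (Fin 2) ℂ) = c • (A : Matrix (Fin 2) (Fin 2) ℂ)

/-- Given positions of the ideal vertices of all tetrahedra, `g` is a face map for the face of
`t` opposite to `v`: it carries the three vertices of that face to the vertices of the
neighbouring tetrahedron to which they are glued. -/
def TetGluing.IsFaceMap (T : TetGluing) (pos : T.Tet → IdealVertex → OnePoint ℂ)
    (t : T.Tet) (v : IdealVertex) (g : PSL(2, ℂ)) : Prop :=
  ∀ w, w ≠ v → Carries g (pos t w) (pos (T.nbr t v) (T.perm t v w))

/-! ## The four-term decomposition -/

/-- The permutation of vertices that fixes `P₋` and `P₊` and sends `strand k` to `strand k'`. -/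
def strandPerm (k k' : Strand) : Equiv.Perm IdealVertex :=
  if k = k' then 1 else Equiv.swap (.strand .one) (.strand .two)

theorem strandPerm_apply (k k' : Strand) : strandPerm k k' (.strand k) = .strand k' := by
  cases k <;> cases k' <;> decide

theorem strandPerm_other (k k' : Strand) :
    strandPerm k k' (.strand k.other) = .strand k'.other := by
  cases k <;> cases k' <;> decide

theorem strandPerm_inv (k k' : Strand) : strandPerm k' k = (strandPerm k k')⁻¹ := by
  cases k <;> cases k' <;> simp [strandPerm]

namespace CrossingGraph

variable {G : CrossingGraph}

theorem Strand.outSide_incoming (k : Strand) (b : Bool) :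
    (k.outSide b).incoming k = false := by
  cases k <;> cases b <;> rfl

theorem Strand.inSide_incoming (k : Strand) (b : Bool) : (k.inSide b).incoming k = true := by
  cases k <;> cases b <;> rfl

theorem Strand.outSide_isLeft (k : Strand) (b : Bool) : (k.outSide b).isLeft k = b := by
  cases k <;> cases b <;> rfl

theorem Strand.inSide_isLeft (k : Strand) (b : Bool) : (k.inSide b).isLeft k = b := by
  cases k <;> cases b <;> rfl

theorem Side.inSide_eq {K : Side} {k : Strand} (h : K.incoming k = true) :
    k.inSide (K.isLeft k) = K := by
  cases K <;> cases k <;> first | rfl | cases h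

theorem Side.outSide_eq {K : Side} {k : Strand} (h : ¬ K.incoming k = true) :
    k.outSide (K.isLeft k) = K := by
  cases K <;> cases k <;> first | rfl | exact absurd rfl h

theorem along_aux (t : G.Corner) (k : Strand) :
    (t.along k).along (t.alongStrand k) = t ∧
      (t.along k).alongStrand (t.alongStrand k) = k := by
  obtain ⟨c, K⟩ := t
  by_cases h : K.incoming k = true
  · have e1 : Corner.along ⟨c, K⟩ k = G.tailCorner (G.head.symm (c, k)) (K.isLeft k) := by
      simp [Corner.along, Corner.segment, h]
    have e2 : Corner.alongStrand ⟨c, K⟩ k = (G.tail (G.head.symm (c, k))).2 := by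
      simp [Corner.alongStrand, Corner.segment, h]
    rw [e1, e2]
    constructor
    · simp [Corner.along, Corner.segment, tailCorner, Strand.outSide_incoming,
        Strand.outSide_isLeft, headCorner, Side.inSide_eq h]
    · simp [Corner.alongStrand, Corner.segment, tailCorner, Strand.outSide_incoming]
  · have e1 : Corner.along ⟨c, K⟩ k = G.headCorner (G.tail.symm (c, k)) (K.isLeft k) := by
      simp [Corner.along, Corner.segment, h]
    have e2 : Corner.alongStrand ⟨c, K⟩ k = (G.head (G.tail.symm (c, k))).2 := by
      simp [Corner.alongStrand, Corner.segment, h]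
    rw [e1, e2]
    constructor
    · simp [Corner.along, Corner.segment, headCorner, Strand.inSide_incoming,
        Strand.inSide_isLeft, tailCorner, Side.outSide_eq h]
    · simp [Corner.alongStrand, Corner.segment, headCorner, Strand.inSide_incoming]

theorem Corner.across_across (t : G.Corner) (k : Strand) : (t.across k).across k = t := by
  obtain ⟨c, K⟩ := t
  cases K <;> cases k <;> rfl

end CrossingGraph

theorem Strand.other_other (k : Strand) : k.other.other = k := by cases k <;> rfl

namespace LinkDiagram

variable (D : LinkDiagram)

/-- The tetrahedron across the face opposite to a vertex.  The face `P₁ P₂ P₊` opposite to `P₋`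
lies above the under-strand of the crossing and below the over-strand, and one crosses the
adjacent segment of the under-strand through it; the face `P₁ P₂ P₋` lies below the over-strand,
and one crosses the adjacent segment of the over-strand through it.  The face opposite to `P_k`
contains `P₋`, `P₊` and the vertex on the other strand; it is glued to the face at the other end
and on the same side of the segment of that strand. -/
def fourTermNbr (t : D.Corner) : IdealVertex → D.Corner
  | .strand k => t.along k.other
  | .minus => t.across (D.underStrand t.crossing)
  | .plus => t.across (D.overStrand t.crossing)

/-- The vertex identifications of the face gluings. -/
def fourTermPerm (t : D.Corner) : IdealVertex → Equiv.Perm IdealVertex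
  | .strand k => strandPerm k.other (t.alongStrand k.other)
  | .minus => 1
  | .plus => 1

/-- The four-term decomposition: the octahedron at each crossing is cut along `P₁ P₂` into four
tetrahedra, one for each corner. -/
def fourTerm : TetGluing where
  Tet := D.Corner
  nbr := D.fourTermNbr
  perm := D.fourTermPerm
  nbr_nbr t v := by
    cases v with
    | strand k =>
      have h : D.fourTermPerm t (.strand k) (.strand k)
          = .strand (t.alongStrand k.other).other := by
        have := strandPerm_other k.other (t.alongStrand k.other)
        rwa [Strand.other_other] at this
      rw [h]
      change (t.along k.other).along (t.alongStrand k.other).other.other = t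
      rw [Strand.other_other]
      exact (CrossingGraph.along_aux t k.other).1
    | minus => exact t.across_across _
    | plus => exact t.across_across _
  perm_perm t v := by
    cases v with
    | strand k =>
      have h : D.fourTermPerm t (.strand k) (.strand k)
          = .strand (t.alongStrand k.other).other := by
        have := strandPerm_other k.other (t.alongStrand k.other)
        rwa [Strand.other_other] at this
      rw [h]
      change strandPerm (t.alongStrand k.other).other.other
        ((t.along k.other).alongStrand (t.alongStrand k.other).other.other) = _
      rw [Strand.other_other, (CrossingGraph.along_aux t k.other).2]
      exact strandPerm_inv _ _
    | minus => exact inv_one.symm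
    | plus => exact inv_one.symm

/-- The path in the fundamental groupoid of the diagram corresponding to the passage through a
face: a passage through `P₁ P₂ P₊` goes above the under-strand, a passage through `P₁ P₂ P₋` goes
below the over-strand, and a passage through a face `P_k P₋ P₊` stays in a region. -/
noncomputable def facePath (t : D.Corner) (v : IdealVertex) :
    D.obj t.region ⟶ D.obj (D.fourTermNbr t v).region :=
  match v with
  | .strand k => eqToHom (congrArg D.obj (t.region_along k.other))
  | .minus => D.crossPath t (D.underStrand t.crossing) true
  | .plus => D.crossPath t (D.overStrand t.crossing) false

/-- The comparison of the dual graph of the four-term decomposition with the fundamental groupoid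
of the diagram: a tetrahedron is sent to its region, a face to the path through it. -/
noncomputable def comparison : D.fourTerm.Dual ⥤q D.PathGroupoid where
  obj t := D.obj (CrossingGraph.Corner.region (G := D.toCrossingGraph) t)
  map {t _} e := D.facePath t e.vertex ≫
    eqToHom (congrArg (fun u => D.obj (CrossingGraph.Corner.region u)) e.nbr_eq)

end LinkDiagram

/-- The positions of the ideal vertices: `P₋` at `0`, `P₊` at `∞`, and `P₁`, `P₂` determined by the
shapes. -/
noncomputable def Shaping.pos {D : LinkDiagram} (χ : Shaping D) (t : D.fourTerm.Tet) :
    IdealVertex → OnePoint ℂ :=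
  let c := CrossingGraph.Corner.crossing (G := D.toCrossingGraph) t
  let χ₁ := χ.shape (D.s₁ c)
  let χ₂ := χ.shape (D.s₂ c)
  let χ₁' := χ.shape (D.s₁' c)
  let χ₂' := χ.shape (D.s₂' c)
  fun v => match CrossingGraph.Corner.side (G := D.toCrossingGraph) t, v with
    | _, .minus => ((0 : ℂ) : OnePoint ℂ)
    | _, .plus => OnePoint.infty
    | .N, .strand .one => ((-1 / χ₁.b : ℂ) : OnePoint ℂ)
    | .N, .strand .two => ((-1 / χ₂'.b : ℂ) : OnePoint ℂ)
    | .W, .strand .one => ((-1 / (χ₁.m * χ₁.b) : ℂ) : OnePoint ℂ)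
    | .W, .strand .two => ((-1 / χ₂.b : ℂ) : OnePoint ℂ)
    | .S, .strand .one => ((-1 / (χ₁.m * χ₁'.b) : ℂ) : OnePoint ℂ)
    | .S, .strand .two => ((-1 / (χ₂.m * χ₂.b) : ℂ) : OnePoint ℂ)
    | .E, .strand .one => ((-1 / χ₁'.b : ℂ) : OnePoint ℂ)
    | .E, .strand .two => ((-1 / (χ₂.m * χ₂'.b) : ℂ) : OnePoint ℂ)

/-- `g` is a face map of the four-term decomposition. -/
def Shaping.IsFaceMap {D : LinkDiagram} (χ : Shaping D) (t : D.fourTerm.Tet) (v : IdealVertex)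
    (g : PSL(2, ℂ)) : Prop :=
  D.fourTerm.IsFaceMap χ.pos t v g

/-! Statements about groupoids are tested on representations in groups: two morphisms are equal once
all representations give them the same value (`GroupoidRep.hom_ext`). A representation of Π₁(D)
amounts to group elements `X s ε`, one for each generator, subject to `Relations`; so homotopies
become identities in an arbitrary group.

Φ is well defined because the values of the passages through faces are the increments of a potential
on flags (`Relations.exists_flagPotential`), so that full turns around edges are trivial. Around
P₋P₊ all passages are trivial. Around P₁P₂ the potential closes up by the relation for passing
between the strands. Around P_kP_± one travels along the strand from one crossing where it is passed
to the next one, and the relation for passing both strands on the same side applies in between.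

Conversely, let a representation of Π₁(T) be given. Turns around P₋P₊ are trivial, so a gauge change
makes it trivial on passages within regions (`exists_gauge`). Then `X s ε` is recovered as the value
of the partial turn around an edge P_kP_± from the left to the right of s, and the turns around the
edges give back `Relations` (`OverAndUnder.exists_relations`). Thus every representation is a
pullback along Φ up to gauge, and Φ is faithful. It is full because each generator is realized by
following the link component to a crossing where it can be passed: above it where it runs under,
below it where it runs over (`OverAndUnder.Realizes.segment`).

The braiding equations yield the matrix relations at crossings, so ρ exists. The representation hol
is defined as the class of ρ∘Φ. The agreement of the holonomies is then built in, and the content is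
that the matrices are face maps (`Shaping.rightMobius_faceVal`): x⁺ fixes ∞ and x⁻ fixes 0, both
carry −1/b to −1/(mb), and the formulas for b₁' and b₂' say where the vertex on the other strand
goes. Pinching means that P₁ and P₂ coincide in one of the four tetrahedra; otherwise three distinct
points determine the face map. -/

/-! ### Representations of groupoids in groups -/

namespace GroupoidRep

variable {𝒢 : Type} [Groupoid.{0} 𝒢] {G : Type} [Group G]

theorem val_inv (R : GroupoidRep 𝒢 G) {x y : 𝒢} (f : x ⟶ y) :
    R.val (Groupoid.inv f) = (R.val f)⁻¹ := by
  rw [eq_inv_iff_mul_eq_one, ← R.val_comp, Groupoid.inv_comp, R.val_id]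

theorem val_eqToHom (R : GroupoidRep 𝒢 G) {x y : 𝒢} (h : x = y) : R.val (eqToHom h) = 1 := by
  subst h
  exact R.val_id x

/-- The representation obtained by a change of gauge. -/
def gauge (R : GroupoidRep 𝒢 G) (c : 𝒢 → G) : GroupoidRep 𝒢 G where
  val {x y} f := c x * R.val f * (c y)⁻¹
  val_id x := by simp [R.val_id]
  val_comp f g := by simp [R.val_comp, mul_assoc]

/-- The pullback of a representation along a functor. -/
def comp {ℋ : Type} [Groupoid.{0} ℋ] (R : GroupoidRep 𝒢 G) (F : ℋ ⥤ 𝒢) : GroupoidRep ℋ G where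
  val f := R.val (F.map f)
  val_id x := by rw [F.map_id, R.val_id]
  val_comp f g := by rw [F.map_comp, R.val_comp]

/-- The composition of a representation with a homomorphism of groups. -/
def push {H : Type} [Group H] (R : GroupoidRep 𝒢 G) (φ : G →* H) : GroupoidRep 𝒢 H where
  val f := φ (R.val f)
  val_id x := by rw [R.val_id, map_one]
  val_comp f g := by rw [R.val_comp, map_mul]

open scoped Classical in
/-- The representation in the vertex group of `x` given by a choice of paths from `x` to the
objects of its component. -/
noncomputable def vertexRep (x : 𝒢) : GroupoidRep 𝒢 (x ⟶ x) where
  val {y z} f :=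
    -- By proof irrelevance the return path is the one chosen for the target of `f`, so products
    -- telescope. Morphisms outside the component of `x` get the value 1.
    if h : Nonempty (x ⟶ y) then
      h.some ≫ f ≫ Groupoid.inv (Nonempty.intro (h.some ≫ f)).some
    else 𝟙 x
  val_id y := by
    by_cases h : Nonempty (x ⟶ y)
    · simp only [h, dif_pos, Category.id_comp]
      exact Groupoid.comp_inv _
    · simp only [h, dif_neg, not_false_eq_true]
      rfl
  val_comp {y z w} f g := by
    by_cases h : Nonempty (x ⟶ y)
    · have hz : Nonempty (x ⟶ z) := ⟨h.some ≫ f⟩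
      simp only [h, hz, dif_pos]
      change _ = (_ ≫ _)
      simp
    · have hz : ¬ Nonempty (x ⟶ z) := fun k => h ⟨k.some ≫ Groupoid.inv f⟩
      simp only [h, hz, dif_neg, not_false_eq_true]
      exact (one_mul (1 : x ⟶ x)).symm

/-- Representations in groups separate the morphisms of a groupoid. -/
theorem hom_ext {x y : 𝒢} {f g : x ⟶ y}
    (h : ∀ (G : Type) [Group G] (R : GroupoidRep 𝒢 G), R.val f = R.val g) : f = g := by
  have := h _ (vertexRep x)
  have hx : Nonempty (x ⟶ x) := ⟨𝟙 x⟩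
  simp only [vertexRep, hx, dif_pos] at this
  exact (cancel_mono (Groupoid.inv (Nonempty.intro (hx.some ≫ f)).some)).1
    ((cancel_epi hx.some).1 this)

/-- A representation of a groupoid that respects relations descends to the quotient. -/
def quotient {r : HomRel 𝒢} (R : GroupoidRep 𝒢 G)
    (H : ∀ (x y : 𝒢) (f g : x ⟶ y), r f g → R.val f = R.val g) :
    GroupoidRep (CategoryTheory.Quotient r) G where
  val f := Quot.liftOn f (fun f => R.val f) (by
    rintro _ _ ⟨_, _, _, _, _, _, h⟩
    simp [R.val_comp, H _ _ _ _ h])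
  val_id x := R.val_id x.as
  val_comp := by
    rintro a b c ⟨f⟩ ⟨g⟩
    exact R.val_comp f g

/-- The representation of a free groupoid with given values on the generators. -/
def free {V : Type} [Quiver.{0} V] (φ : ∀ {x y : V}, (x ⟶ y) → G) :
    GroupoidRep (Quiver.FreeGroupoid V) G where
  -- Composition in `SingleObj` multiplies in reverse order; the opposite group restores reading
  -- from left to right.
  val f := MulOpposite.unop ((Quiver.FreeGroupoid.lift
    ({ obj := fun _ => SingleObj.star Gᵐᵒᵖ, map := fun e => MulOpposite.op (φ e) } :
      V ⥤q SingleObj Gᵐᵒᵖ)).map f : Gᵐᵒᵖ)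
  val_id x := congrArg MulOpposite.unop (CategoryTheory.Functor.map_id _ x)
  val_comp f g := congrArg MulOpposite.unop (CategoryTheory.Functor.map_comp _ f g)

theorem free_val {V : Type} [Quiver.{0} V] (φ : ∀ {x y : V}, (x ⟶ y) → G) {x y : V} (e : x ⟶ y) :
    (free φ).val ((Quiver.FreeGroupoid.of V).map e) = φ e :=
  one_mul _

end GroupoidRep

namespace Quiver.FreeGroupoid

variable {V : Type} [Quiver.{0} V]

/-- Induction on the morphisms of a free groupoid. -/
theorem hom_induction {P : ∀ {x y : Quiver.FreeGroupoid V}, (x ⟶ y) → Prop}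
    (id : ∀ x : Quiver.FreeGroupoid V, P (𝟙 x))
    (of : ∀ {x y : V} (e : x ⟶ y), P ((Quiver.FreeGroupoid.of V).map e))
    (inv : ∀ {x y : Quiver.FreeGroupoid V} (f : x ⟶ y), P f → P (Groupoid.inv f))
    (comp : ∀ {x y z : Quiver.FreeGroupoid V} (f : x ⟶ y) (g : y ⟶ z), P f → P g → P (f ≫ g))
    {x y : Quiver.FreeGroupoid V} (f : x ⟶ y) : P f := by
  obtain ⟨x⟩ := x
  obtain ⟨y⟩ := y
  obtain ⟨p⟩ := f
  have key : ∀ (y : V) (p : Quiver.Path (V := Quiver.Symmetrify V) x y),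
      P (x := ⟨x⟩) (y := ⟨y⟩) (Quot.mk _ p) := by
    intro y p
    induction p with
    | nil => exact id _
    | cons p e ih =>
      obtain e | e := e
      · exact comp _ _ ih (of e)
      · exact comp _ _ ih (inv _ (of e))
  exact key y p

theorem lift_map_of {𝒢 : Type} [Groupoid.{0} 𝒢] (φ : V ⥤q 𝒢) {x y : V} (e : x ⟶ y) :
    (lift φ).map ((Quiver.FreeGroupoid.of V).map e) = φ.map e :=
  Category.id_comp (φ.map e)

end Quiver.FreeGroupoid

theorem GroupoidRep.eq_of_eq_on_generators {V : Type} [Quiver.{0} V] {G : Type} [Group G]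
    (R R' : GroupoidRep (Quiver.FreeGroupoid V) G)
    (h : ∀ {x y : V} (e : x ⟶ y), R.val ((Quiver.FreeGroupoid.of V).map e)
      = R'.val ((Quiver.FreeGroupoid.of V).map e))
    {x y : Quiver.FreeGroupoid V} (f : x ⟶ y) : R.val f = R'.val f := by
  induction f using Quiver.FreeGroupoid.hom_induction with
  | id x => rw [R.val_id, R'.val_id]
  | of e => exact h e
  | inv f ih => rw [R.val_inv, R'.val_inv, ih]
  | comp f g hf hg => rw [R.val_comp, R'.val_comp, hf, hg]

/-! ### Recursion and potentials along the cycles of a permutation -/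

section Cycles

variable {S : Type*} (σ : Equiv.Perm S)

/-- Induction along the cycles of a permutation, starting from a set that meets every cycle. -/
theorem Equiv.Perm.cycle_induction [Finite S] {O : S → Prop}
    (hO : ∀ s, ∃ s', σ.SameCycle s s' ∧ O s') {P : S → Prop} (start : ∀ s, O s → P s)
    (step : ∀ s, ¬ O s → P (σ s) → P s) (s : S) : P s := by
  obtain ⟨s', h, h'⟩ := hO s
  obtain ⟨n, -, rfl⟩ := h.exists_pow_eq'
  induction n generalizing s with
  | zero => exact start s h'
  | succ n ih =>
    by_cases hs : O s
    · exact start s hs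
    · refine step s hs (ih (σ s) ?_ ?_)
      · rw [pow_succ, Equiv.Perm.mul_apply] at h
        exact ⟨n, by simp⟩
      · rwa [pow_succ, Equiv.Perm.mul_apply] at h'

/-- Recursion along the cycles of a permutation, starting from a set that meets every cycle. -/
theorem Equiv.Perm.exists_cycle_recursion [Finite S] {O : S → Prop}
    (hO : ∀ s, ∃ s', σ.SameCycle s s' ∧ O s') {α : Type*} (i : S → α) (φ : S → α → α) :
    ∃ h : S → α, (∀ s, O s → h s = i s) ∧ ∀ s, ¬ O s → h s = φ s (h (σ s)) := by
  classical
  have hn : ∀ s, ∃ n : ℕ, O ((σ ^ n) s) := fun s => by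
    obtain ⟨s', h, h'⟩ := hO s
    obtain ⟨n, -, rfl⟩ := h.exists_pow_eq'
    exact ⟨n, h'⟩
  -- `F n s` runs the recursion for `n` steps; it is used with `n` the first time at which the orbit
  -- of `s` meets `O`.
  let F : ℕ → S → α := fun n => Nat.rec i (fun _ f s => φ s (f (σ s))) n
  refine ⟨fun s => F (Nat.find (hn s)) s, fun s hs => ?_, fun s hs => ?_⟩
  · have : Nat.find (hn s) = 0 := (Nat.find_eq_zero _).2 hs
    simp only [this]
    rfl
  · have : Nat.find (hn s) = Nat.find (hn (σ s)) + 1 := by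
      rw [Nat.find_eq_iff]
      constructor
      · have := Nat.find_spec (hn (σ s))
        rwa [pow_succ, Equiv.Perm.mul_apply]
      · intro m hm
        cases m with
        | zero => exact hs
        | succ m =>
          rw [pow_succ, Equiv.Perm.mul_apply]
          exact Nat.find_min (hn (σ s)) (by omega)
    simp only [this]
    rfl

/-- The product of `γ` along `n` steps of a permutation. -/
def Equiv.Perm.walk {G : Type*} [Group G] (γ : S → G) : ℕ → S → G
  | 0, _ => 1
  | n + 1, s => γ s * Equiv.Perm.walk γ n (σ s)

theorem Equiv.Perm.walk_add {G : Type*} [Group G] (γ : S → G) (m n : ℕ) (s : S) :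
    σ.walk γ (m + n) s = σ.walk γ m s * σ.walk γ n ((σ ^ m) s) := by
  induction m generalizing s with
  | zero => simp [walk]
  | succ m ih =>
    rw [Nat.add_right_comm, walk, ih, walk, mul_assoc, pow_succ, Equiv.Perm.mul_apply]

/-- A cocycle on the cycles of a permutation that is trivial on closed walks is a coboundary. -/
theorem Equiv.Perm.exists_potential [Finite S] {G : Type*} [Group G] (γ : S → G)
    (hγ : ∀ n s, (σ ^ n) s = s → σ.walk γ n s = 1) :
    ∃ h : S → G, ∀ s, h (σ s) = h s * γ s := by
  -- Two walks from `s` with the same end differ by a closed walk, so the product depends only on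
  -- the end.
  have key : ∀ s m n, (σ ^ m) s = (σ ^ n) s → σ.walk γ m s = σ.walk γ n s := by
    intro s m n h
    wlog hmn : m ≤ n generalizing m n
    · exact (this n m h.symm (by omega)).symm
    obtain ⟨d, rfl⟩ := Nat.exists_eq_add_of_le hmn
    rw [walk_add, hγ d, mul_one]
    rw [add_comm, pow_add, Equiv.Perm.mul_apply] at h
    exact h.symm
  -- One base point per cycle; the potential at `s` is the product along a walk from the base point
  -- to `s`.
  let b : S → S := fun s => (Quotient.mk (SameCycle.setoid σ) s).out
  have hb : ∀ s, ∃ n : ℕ, (σ ^ n) (b s) = s := fun s => by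
    have : σ.SameCycle (b s) s := Quotient.exact (s := SameCycle.setoid σ) (Quotient.out_eq _)
    obtain ⟨n, -, h⟩ := this.exists_pow_eq'
    exact ⟨n, h⟩
  choose n hn using hb
  refine ⟨fun s => σ.walk γ (n s) (b s), fun s => ?_⟩
  have hbs : b (σ s) = b s := by
    have : Quotient.mk (SameCycle.setoid σ) (σ s) = Quotient.mk (SameCycle.setoid σ) s :=
      Quotient.sound (s := SameCycle.setoid σ) (Equiv.Perm.sameCycle_apply_left.2 (Equiv.Perm.SameCycle.refl σ s))
    exact congrArg Quotient.out this
  have h1 := hn (σ s)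
  rw [hbs] at h1
  have h2 := key (b s) (n (σ s)) (n s + 1) (by
    rw [h1, add_comm, pow_add, Equiv.Perm.mul_apply, hn, pow_one])
  simp only [hbs, h2]
  rw [walk_add, hn]
  simp [walk]

end Cycles

/-! ### Values of representations on generators and on passages through faces -/

namespace CrossingGraph

variable {G : CrossingGraph}

theorem Corner.segment_along (t : G.Corner) (k : Strand) :
    (t.along k).segment (t.alongStrand k) = t.segment k := by
  obtain ⟨c, K⟩ := t
  by_cases h : K.incoming k = true
  · simp [Corner.along, Corner.alongStrand, Corner.segment, h, tailCorner,
      Strand.outSide_incoming]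
  · simp [Corner.along, Corner.alongStrand, Corner.segment, h, headCorner,
      Strand.inSide_incoming]

theorem Corner.isLeft_along (t : G.Corner) (k : Strand) :
    (t.along k).side.isLeft (t.alongStrand k) = t.side.isLeft k := by
  obtain ⟨c, K⟩ := t
  by_cases h : K.incoming k = true
  · simp [Corner.along, Corner.alongStrand, Corner.segment, h, tailCorner,
      Strand.outSide_isLeft]
  · simp [Corner.along, Corner.alongStrand, Corner.segment, h, headCorner,
      Strand.inSide_isLeft]

end CrossingGraph

/-- The vertex opposite to the face through which one passes above (`true`) or below (`false`) a
strand. -/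
def IdealVertex.pass : Bool → IdealVertex
  | true => .minus
  | false => .plus

theorem IdealVertex.strand_ne_pass (k : Strand) (ε : Bool) : strand k ≠ pass ε := by
  cases ε <;> simp [pass]

namespace LinkDiagram

variable {D : LinkDiagram}

/-- The strand of a crossing that one passes above (`true`) or below (`false`) within the
octahedron of the crossing. -/
def passStrand (D : LinkDiagram) (c : D.Crossing) : Bool → Strand
  | true => D.underStrand c
  | false => D.overStrand c

theorem fourTermNbr_pass (t : D.Corner) (ε : Bool) :
    D.fourTermNbr t (.pass ε) = t.across (D.passStrand t.crossing ε) := by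
  cases ε <;> rfl

theorem fourTermPerm_pass (t : D.Corner) (ε : Bool) : D.fourTermPerm t (.pass ε) = 1 := by
  cases ε <;> rfl

theorem strandPerm_strand (j k l : Strand) :
    ∃ l', strandPerm j k (.strand l) = .strand l' := by
  cases j <;> cases k <;> cases l <;>
    first | exact ⟨.one, by decide⟩ | exact ⟨.two, by decide⟩

theorem strandPerm_pass (j k : Strand) (ε : Bool) : strandPerm j k (.pass ε) = .pass ε := by
  cases j <;> cases k <;> cases ε <;> decide

theorem OverAndUnder.exists_pass (hD : D.OverAndUnder) (ε : Bool) (s : D.Segment) :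
    ∃ s', D.nextSegment.SameCycle s s' ∧
      (D.head s').2 = D.passStrand (D.head s').1 ε := by
  cases ε
  · exact (hD s).1
  · exact (hD s).2

instance : Finite D.Crossing := D.finiteCrossing

instance : Finite Strand :=
  Finite.of_injective (fun k : Strand => decide (k = .one)) (by
    intro a b h
    cases a <;> cases b <;> simp_all)

instance : Finite Side :=
  Finite.of_injective (fun K : Side => (K.incoming .one, K.incoming .two)) (by
    intro a b h
    cases a <;> cases b <;> simp_all [Side.incoming])

instance : Finite D.Segment := Finite.of_equiv _ D.tail.symm

instance : Finite D.Corner :=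
  Finite.of_injective (fun t : D.Corner => (t.crossing, t.side)) (by
    rintro ⟨_, _⟩ ⟨_, _⟩ h
    simp_all)

theorem nextSegment_head_symm (c : D.Crossing) (k : Strand) :
    D.nextSegment (D.head.symm (c, k)) = D.tail.symm (c, k) := by
  simp [CrossingGraph.nextSegment]

variable {G : Type} [Group G]

/-- The relations of the fundamental groupoid of a diagram, for elements of a group assigned to
its generators. -/
structure Relations (X : D.Segment → Bool → G) : Prop where
  same (c : D.Crossing) (ε : Bool) :
    X (D.s₁ c) ε * X (D.s₂ c) ε = X (D.s₂' c) ε * X (D.s₁' c) ε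
  between_pos (c : D.Crossing) (h : D.positive c = true) :
    X (D.s₁ c) false * X (D.s₂ c) true = X (D.s₂' c) true * X (D.s₁' c) false
  between_neg (c : D.Crossing) (h : D.positive c = false) :
    X (D.s₁ c) true * X (D.s₂ c) false = X (D.s₂' c) false * X (D.s₁' c) true

/-- The representation of the fundamental groupoid of a diagram given by the values on
generators. -/
noncomputable def pathRep (X : D.Segment → Bool → G) (h : Relations X) :
    GroupoidRep D.PathGroupoid G :=
  (GroupoidRep.free (V := D.RegionVertex)
    (fun {x y} (e : x ⟶ y) => X (PathGen.seg (D := D) (r := x) (r' := y) e)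
      (PathGen.above (D := D) (r := x) (r' := y) e))).quotient (by
    rintro x y f g (⟨c, ε⟩ | ⟨c, h'⟩ | ⟨c, h'⟩) <;> rw [GroupoidRep.val_comp, GroupoidRep.val_comp]
    · convert h.same c ε <;> exact GroupoidRep.free_val _ _
    · convert h.between_pos c h' <;> exact GroupoidRep.free_val _ _
    · convert h.between_neg c h' <;> exact GroupoidRep.free_val _ _)

theorem pathRep_gen (X : D.Segment → Bool → G) (h : Relations X) {r r' : D.Region}
    (g : D.PathGen r r') : (pathRep X h).val (D.gen g) = X g.seg g.above :=
  GroupoidRep.free_val _ _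

theorem val_gen (R : GroupoidRep D.PathGroupoid G) {r r' : D.Region} (g : D.PathGen r r') :
    R.val (D.gen g) = R.val (D.segmentPath g.seg g.above) := by
  obtain ⟨s, ε, rfl, rfl⟩ := g
  rfl

theorem val_x₁ (R : GroupoidRep D.PathGroupoid G) (c : D.Crossing) (ε : Bool) :
    R.val ((CategoryTheory.Quotient.functor D.CrossingRel).map (D.x₁ c ε))
      = R.val (D.segmentPath (D.s₁ c) ε) :=
  val_gen R ⟨D.s₁ c, ε, CrossingGraph.Corner.region_eq ⟨c, .N⟩ .one,
    CrossingGraph.Corner.region_eq ⟨c, .W⟩ .one⟩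

theorem val_x₂ (R : GroupoidRep D.PathGroupoid G) (c : D.Crossing) (ε : Bool) :
    R.val ((CategoryTheory.Quotient.functor D.CrossingRel).map (D.x₂ c ε))
      = R.val (D.segmentPath (D.s₂ c) ε) :=
  val_gen R ⟨D.s₂ c, ε, CrossingGraph.Corner.region_eq ⟨c, .W⟩ .two,
    CrossingGraph.Corner.region_eq ⟨c, .S⟩ .two⟩

theorem val_x₂' (R : GroupoidRep D.PathGroupoid G) (c : D.Crossing) (ε : Bool) :
    R.val ((CategoryTheory.Quotient.functor D.CrossingRel).map (D.x₂' c ε))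
      = R.val (D.segmentPath (D.s₂' c) ε) :=
  val_gen R ⟨D.s₂' c, ε, CrossingGraph.Corner.region_eq ⟨c, .N⟩ .two,
    CrossingGraph.Corner.region_eq ⟨c, .E⟩ .two⟩

theorem val_x₁' (R : GroupoidRep D.PathGroupoid G) (c : D.Crossing) (ε : Bool) :
    R.val ((CategoryTheory.Quotient.functor D.CrossingRel).map (D.x₁' c ε))
      = R.val (D.segmentPath (D.s₁' c) ε) :=
  val_gen R ⟨D.s₁' c, ε, CrossingGraph.Corner.region_eq ⟨c, .E⟩ .one,
    CrossingGraph.Corner.region_eq ⟨c, .S⟩ .one⟩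

/-- Together with `pathRep`, this identifies the representations of Π₁(D) in a group with the
solutions of the relations. -/
theorem relations_of_rep (R : GroupoidRep D.PathGroupoid G) :
    Relations (fun s ε => R.val (D.segmentPath s ε)) where
  same c ε := by
    have := congrArg R.val (CategoryTheory.Quotient.sound _ (CrossingRel.same c ε))
    rwa [Functor.map_comp, Functor.map_comp, R.val_comp, R.val_comp, val_x₁, val_x₂, val_x₂',
      val_x₁'] at this
  between_pos c h := by
    have := congrArg R.val (CategoryTheory.Quotient.sound _ (CrossingRel.between_pos c h))
    rwa [Functor.map_comp, Functor.map_comp, R.val_comp, R.val_comp, val_x₁, val_x₂, val_x₂',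
      val_x₁'] at this
  between_neg c h := by
    have := congrArg R.val (CategoryTheory.Quotient.sound _ (CrossingRel.between_neg c h))
    rwa [Functor.map_comp, Functor.map_comp, R.val_comp, R.val_comp, val_x₁, val_x₂, val_x₂',
      val_x₁'] at this

/-- The value of the path from a corner across the adjacent segment of strand `k`. -/
def crossVal (X : D.Segment → Bool → G) (t : D.Corner) (k : Strand) (ε : Bool) : G :=
  if t.side.isLeft k then X (t.segment k) ε else (X (t.segment k) ε)⁻¹

theorem val_crossPath (R : GroupoidRep D.PathGroupoid G) (t : D.Corner) (k : Strand) (ε : Bool) :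
    R.val (D.crossPath t k ε) = crossVal (fun s ε => R.val (D.segmentPath s ε)) t k ε := by
  unfold crossPath crossVal
  split
  · exact val_gen R _
  · rw [R.val_inv]
    exact congrArg _ (val_gen R _)

/-- The value of the path of the passage through a face. -/
def faceVal (X : D.Segment → Bool → G) (t : D.Corner) : IdealVertex → G
  | .strand _ => 1
  | .minus => crossVal X t (D.passStrand t.crossing true) true
  | .plus => crossVal X t (D.passStrand t.crossing false) false

theorem faceVal_pass (X : D.Segment → Bool → G) (t : D.Corner) (ε : Bool) :
    faceVal X t (.pass ε) = crossVal X t (D.passStrand t.crossing ε) ε := by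
  cases ε <;> rfl

theorem val_facePath (R : GroupoidRep D.PathGroupoid G) (t : D.Corner) (v : IdealVertex) :
    R.val (D.facePath t v) = faceVal (fun s ε => R.val (D.segmentPath s ε)) t v := by
  cases v with
  | strand k => exact R.val_eqToHom (congrArg D.obj (t.region_along k.other))
  | minus => exact val_crossPath R t _ _
  | plus => exact val_crossPath R t _ _

/-- Passing across a strand `k.other` commutes with passing across strand `k`, both being above
or both below. -/
theorem Relations.slide {X : D.Segment → Bool → G} (h : Relations X) (c : D.Crossing) (k : Strand)
    (ε : Bool) :
    X (D.head.symm (c, k)) ε * crossVal X ⟨c, k.inSide false⟩ k.other ε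
      = crossVal X ⟨c, k.inSide true⟩ k.other ε * X (D.tail.symm (c, k)) ε := by
  have := h.same c ε
  cases k
  · exact this
  · change X (D.s₂ c) ε * (X (D.s₁' c) ε)⁻¹ = (X (D.s₁ c) ε)⁻¹ * X (D.s₂' c) ε
    rw [mul_inv_eq_iff_eq_mul, mul_assoc, ← this, inv_mul_cancel_left]

/-- A potential on the corners of a crossing for rotation around the edge `P₁ P₂`. -/
def cornerPotential (X : D.Segment → Bool → G) (t : D.Corner) : G :=
  match t.side with
  | .N => 1
  | .W => X (D.s₁ t.crossing) (!D.positive t.crossing)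
  | .S => X (D.s₁ t.crossing) (!D.positive t.crossing) * X (D.s₂ t.crossing) (D.positive t.crossing)
  | .E => X (D.s₂' t.crossing) (D.positive t.crossing)

/-- Inside the octahedron the over-strand is passed below and the under-strand above. Three of the
four steps around P₁P₂ hold by the choice of the potential; the one between S and E is the relation
for passing between the strands. -/
theorem Relations.cornerPotential_across {X : D.Segment → Bool → G} (h : Relations X)
    (t : D.Corner) (ε : Bool) :
    cornerPotential X t * faceVal X t (.pass ε)
      = cornerPotential X (D.fourTermNbr t (.pass ε)) := by
  obtain ⟨c, K⟩ := t
  rw [fourTermNbr_pass, faceVal_pass]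
  cases hc : D.positive c
  · have h' := h.between_neg c hc
    simp only [CrossingGraph.s₁, CrossingGraph.s₂, CrossingGraph.s₁', CrossingGraph.s₂'] at h'
    cases ε <;> cases K <;>
      simp [passStrand, CrossingGraph.underStrand, CrossingGraph.overStrand, hc, Strand.other,
        cornerPotential, crossVal, CrossingGraph.Corner.across, Side.across, Side.isLeft,
        CrossingGraph.Corner.segment, Side.incoming, CrossingGraph.s₁, CrossingGraph.s₂,
        CrossingGraph.s₂', h']
    rw [← h', mul_inv_cancel_right]
  · have h' := h.between_pos c hc
    simp only [CrossingGraph.s₁, CrossingGraph.s₂, CrossingGraph.s₁', CrossingGraph.s₂'] at h'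
    cases ε <;> cases K <;>
      simp [passStrand, CrossingGraph.underStrand, CrossingGraph.overStrand, hc, Strand.other,
        cornerPotential, crossVal, CrossingGraph.Corner.across, Side.across, Side.isLeft,
        CrossingGraph.Corner.segment, Side.incoming, CrossingGraph.s₁, CrossingGraph.s₂,
        CrossingGraph.s₂', h']
    rw [← h', mul_inv_cancel_right]

end LinkDiagram

theorem IdealVertex.strand_or_pass (v : IdealVertex) :
    (∃ k, v = strand k) ∨ ∃ ε, v = pass ε := by
  rcases v with k | _ | _
  · exact .inl ⟨k, rfl⟩
  · exact .inr ⟨true, rfl⟩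
  · exact .inr ⟨false, rfl⟩

theorem Strand.eq_or_eq_other (k k' : Strand) : k' = k ∨ k' = k.other := by
  cases k <;> cases k' <;> simp [Strand.other]

theorem Strand.other_ne (k : Strand) : k.other ≠ k := by
  cases k <;> simp [Strand.other]

/-! ### Turns around edges, and the comparison functor -/

namespace LinkDiagram

variable {D : LinkDiagram} {G : Type} [Group G]

/-- A potential for the passages across the crossings at which a strand is not passed: it
exists because every component is passed somewhere. -/
theorem OverAndUnder.exists_strandPotential (hD : D.OverAndUnder) (X : D.Segment → Bool → G)
    (ε : Bool) : ∃ h : D.Segment → G, ∀ c k, k ≠ D.passStrand c ε →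
      h (D.head.symm (c, k)) * crossVal X ⟨c, k.inSide true⟩ k.other ε
        = h (D.tail.symm (c, k)) := by
  -- Only crossings where the strand is not passed impose a condition. The recursion starts at the
  -- others with the arbitrary value 1, so nothing has to be consistent around a whole component.
  obtain ⟨h, -, hh⟩ := D.nextSegment.exists_cycle_recursion (hD.exists_pass ε) (fun _ => (1 : G))
    (fun s g => g * (crossVal X (D.headCorner s true) (D.head s).2.other ε)⁻¹)
  refine ⟨h, fun c k hk => ?_⟩
  rw [hh (D.head.symm (c, k)) (by simpa using hk), CrossingGraph.headCorner_symm,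
    nextSegment_head_symm, Equiv.apply_symm_apply, inv_mul_cancel_right]

/-- A potential for rotation around the edges `P_k P₋` (passages above, `ε = true`: `P_k P₊`). -/
def edgePotential (X : D.Segment → Bool → G) (h : D.Segment → G) (t : D.Corner) (k : Strand)
    (ε : Bool) : G :=
  if t.side.isLeft k then h (t.segment k) else h (t.segment k) * X (t.segment k) ε

/-- The potential depends only on a segment and a side of it, and both are kept along the segment.
-/
theorem edgePotential_along (X : D.Segment → Bool → G) (h : D.Segment → G) (t : D.Corner)
    (k : Strand) (ε : Bool) :
    edgePotential X h (t.along k) (t.alongStrand k) ε = edgePotential X h t k ε := by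
  simp [edgePotential, CrossingGraph.Corner.segment_along, CrossingGraph.Corner.isLeft_along]

theorem edgePotential_across (X : D.Segment → Bool → G) (h : D.Segment → G) (t : D.Corner)
    (k : Strand) (ε : Bool) :
    edgePotential X h t k ε * crossVal X t k ε = edgePotential X h (t.across k) k ε := by
  simp only [edgePotential, crossVal, CrossingGraph.Corner.segment_across,
    CrossingGraph.Corner.isLeft_across]
  cases t.side.isLeft k <;> simp

/-- On the left of strand `k` this is the condition on `h`; on the right it follows from
`Relations.slide`. The steps from the outgoing to the incoming side are inverse to these. -/
theorem edgePotential_slide {X : D.Segment → Bool → G} (hX : Relations X) {h : D.Segment → G}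
    {ε : Bool} (hh : ∀ c k, k ≠ D.passStrand c ε →
      h (D.head.symm (c, k)) * crossVal X ⟨c, k.inSide true⟩ k.other ε = h (D.tail.symm (c, k)))
    (t : D.Corner) (k : Strand) (hk : k ≠ D.passStrand t.crossing ε) :
    edgePotential X h t k ε * crossVal X t k.other ε
      = edgePotential X h (t.across k.other) k ε := by
  obtain ⟨c, K⟩ := t
  have h1 := hh c k hk
  have h2 := hX.slide c k ε
  have h3 : h (D.head.symm (c, k)) * X (D.head.symm (c, k)) ε *
      crossVal X ⟨c, k.inSide false⟩ k.other ε
        = h (D.tail.symm (c, k)) * X (D.tail.symm (c, k)) ε := by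
    rw [mul_assoc, h2, ← mul_assoc, h1]
  have h4 : ∀ t : D.Corner, crossVal X (t.across k.other) k.other ε
      = (crossVal X t k.other ε)⁻¹ := fun t => by
    simp only [crossVal, CrossingGraph.Corner.segment_across, CrossingGraph.Corner.isLeft_across]
    cases t.side.isLeft k.other <;> simp
  have h5 := h4 ⟨c, k.inSide true⟩
  have h6 := h4 ⟨c, k.inSide false⟩
  cases k <;> cases K
  · exact h1
  · exact h3
  · exact (congrArg (_ * ·) h6).trans (mul_inv_eq_of_eq_mul h3.symm)
  · exact (congrArg (_ * ·) h5).trans (mul_inv_eq_of_eq_mul h1.symm)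
  · exact (congrArg (_ * ·) h5).trans (mul_inv_eq_of_eq_mul h1.symm)
  · exact h1
  · exact h3
  · exact (congrArg (_ * ·) h6).trans (mul_inv_eq_of_eq_mul h3.symm)

/-- The next flag around an edge after a passage above or below a strand. -/
theorem next_pass (t : D.Corner) (ε : Bool) (w : IdealVertex) (h : IdealVertex.pass ε ≠ w) :
    (⟨t, .pass ε, w, h⟩ : D.fourTerm.Flag).next
      = ⟨t.across (D.passStrand t.crossing ε), w, .pass ε, h.symm⟩ := by
  cases ε <;> rfl

/-- The next flag around an edge after a passage along a strand. -/
theorem next_strand_pass (t : D.Corner) (k : Strand) (ε : Bool) :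
    (⟨t, .strand k.other, .pass ε, IdealVertex.strand_ne_pass _ _⟩ : D.fourTerm.Flag).next
      = ⟨t.along k, .pass ε, .strand (t.alongStrand k).other,
        (IdealVertex.strand_ne_pass _ _).symm⟩ := by
  have h1 : D.fourTerm.nbr t (.strand k.other) = t.along k := by
    change t.along k.other.other = _
    rw [Strand.other_other]
  have h2 : D.fourTerm.perm t (.strand k.other) (.pass ε) = .pass ε := strandPerm_pass _ _ _
  have h3 : D.fourTerm.perm t (.strand k.other) (.strand k.other)
      = .strand (t.alongStrand k).other := by
    change strandPerm k.other.other (t.alongStrand k.other.other) _ = _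
    rw [Strand.other_other, strandPerm_other]
  simp only [TetGluing.Flag.next, h1, h2, h3]

/-- A potential for the rotations around all edges. -/
def flagPotential (X : D.Segment → Bool → G) (h : Bool → D.Segment → G)
    (t : D.Corner) : IdealVertex → IdealVertex → G
  | .strand _, .strand _ => 1
  | .strand k, .minus => edgePotential X (h true) t k.other true
  | .minus, .strand k => edgePotential X (h true) t k.other true
  | .strand k, .plus => edgePotential X (h false) t k.other false
  | .plus, .strand k => edgePotential X (h false) t k.other false
  | _, _ => cornerPotential X t

theorem flagPotential_strand_pass (X : D.Segment → Bool → G) (h : Bool → D.Segment → G)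
    (t : D.Corner) (k : Strand) (ε : Bool) :
    flagPotential X h t (.strand k) (.pass ε) = edgePotential X (h ε) t k.other ε := by
  cases ε <;> rfl

theorem flagPotential_pass_strand (X : D.Segment → Bool → G) (h : Bool → D.Segment → G)
    (t : D.Corner) (k : Strand) (ε : Bool) :
    flagPotential X h t (.pass ε) (.strand k) = edgePotential X (h ε) t k.other ε := by
  cases ε <;> rfl

theorem flagPotential_pass_pass (X : D.Segment → Bool → G) (h : Bool → D.Segment → G)
    (t : D.Corner) (ε ε' : Bool) :
    flagPotential X h t (.pass ε) (.pass ε') = cornerPotential X t := by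
  cases ε <;> cases ε' <;> rfl

/-- Each type of edge has its own potential: a constant around P₋P₊, `cornerPotential` around P₁P₂,
and `edgePotential` around P_kP_±. In the last case a passage across strand k itself and a passage
across the other strand are governed by `edgePotential_across` and `edgePotential_slide`. -/
theorem Relations.exists_flagPotential {X : D.Segment → Bool → G} (hX : Relations X)
    (hD : D.OverAndUnder) :
    ∃ ψ : D.fourTerm.Flag → G, ∀ f, ψ f * faceVal X f.tet f.out = ψ f.next := by
  choose h hh using hD.exists_strandPotential X
  refine ⟨fun f => flagPotential X h f.tet f.out f.into, fun f => ?_⟩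
  obtain ⟨t, v, w, hvw⟩ := f
  change D.Corner at t
  obtain ⟨k, rfl⟩ | ⟨ε, rfl⟩ := IdealVertex.strand_or_pass v
  · obtain ⟨l, rfl⟩ | ⟨ε, rfl⟩ := IdealVertex.strand_or_pass w
    · obtain ⟨k', hk'⟩ := strandPerm_strand k.other (t.alongStrand k.other) k
      obtain ⟨l', hl'⟩ := strandPerm_strand k.other (t.alongStrand k.other) l
      change flagPotential X h t (.strand k) (.strand l) * 1 = flagPotential X h _
        (strandPerm k.other (t.alongStrand k.other) (.strand l))
        (strandPerm k.other (t.alongStrand k.other) (.strand k))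
      rw [hk', hl']
      exact mul_one _
    · obtain ⟨k, rfl⟩ : ∃ k', k = Strand.other k' := ⟨_, (Strand.other_other k).symm⟩
      rw [next_strand_pass]
      change flagPotential X h t (.strand k.other) (.pass ε) * 1 = flagPotential X h _ (.pass ε) _
      rw [flagPotential_strand_pass, flagPotential_pass_strand, Strand.other_other,
        Strand.other_other, edgePotential_along, mul_one]
  · rw [next_pass]
    change flagPotential X h t (.pass ε) w * faceVal X t (.pass ε) = flagPotential X h _ w (.pass ε)
    obtain ⟨k, rfl⟩ | ⟨ε', rfl⟩ := IdealVertex.strand_or_pass w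
    · rw [flagPotential_strand_pass, flagPotential_pass_strand, faceVal_pass]
      obtain hk | hk := Strand.eq_or_eq_other k.other (D.passStrand t.crossing ε)
      · rw [hk]
        exact edgePotential_across _ _ _ _ _
      · rw [hk]
        refine edgePotential_slide hX (hh ε) t k.other ?_
        rw [hk]
        exact (Strand.other_ne _).symm
    · rw [flagPotential_pass_pass, flagPotential_pass_pass, hX.cornerPotential_across,
        fourTermNbr_pass]

/-- The comparison on the free groupoid of passages through faces. -/
noncomputable def freeComparison (D : LinkDiagram) : D.fourTerm.FreeDual ⥤ D.PathGroupoid :=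
  Quiver.FreeGroupoid.lift D.comparison

theorem freeComparison_map_freeFace {t t' : D.fourTerm.Tet} (e : D.fourTerm.FaceArrow t t') :
    D.freeComparison.map (D.fourTerm.freeFace e) = D.facePath t e.vertex ≫
      eqToHom (congrArg (fun u => D.obj (CrossingGraph.Corner.region u)) e.nbr_eq) :=
  Quiver.FreeGroupoid.lift_map_of D.comparison (x := t) (y := t') e

theorem val_freeComparison_map (R : GroupoidRep D.PathGroupoid G) {t t' : D.fourTerm.Tet}
    (e : D.fourTerm.FaceArrow t t') :
    (R.comp D.freeComparison).val (D.fourTerm.freeFace e)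
      = faceVal (fun s ε => R.val (D.segmentPath s ε)) t e.vertex := by
  refine (congrArg R.val (freeComparison_map_freeFace e)).trans ((R.val_comp _ _).trans ?_)
  exact (congrArg (_ * ·) (R.val_eqToHom _)).trans ((mul_one _).trans (val_facePath R t e.vertex))

theorem faceVal_back {X : D.Segment → Bool → G} (t : D.Corner) (v : IdealVertex) :
    faceVal X t v * faceVal X (D.fourTermNbr t v) (D.fourTermPerm t v v) = 1 := by
  obtain ⟨k, rfl⟩ | ⟨ε, rfl⟩ := IdealVertex.strand_or_pass v
  · obtain ⟨k', hk'⟩ := strandPerm_strand k.other (t.alongStrand k.other) k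
    change 1 * faceVal X _ (strandPerm k.other (t.alongStrand k.other) (.strand k)) = 1
    rw [hk']
    exact one_mul 1
  · rw [fourTermNbr_pass, fourTermPerm_pass, Equiv.Perm.one_apply, faceVal_pass, faceVal_pass]
    change crossVal X t _ ε * crossVal X (t.across _) (D.passStrand t.crossing ε) ε = 1
    simp only [crossVal, CrossingGraph.Corner.segment_across, CrossingGraph.Corner.isLeft_across]
    cases t.side.isLeft (D.passStrand t.crossing ε) <;> simp

/-- In every representation a full turn multiplies the potential of its flag by its value and
returns to the same flag; hence the value is 1. -/
theorem OverAndUnder.freeComparison_respects (hD : D.OverAndUnder) (x y : D.fourTerm.FreeDual)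
    (f g : x ⟶ y) (h : D.fourTerm.DualRel f g) :
    D.freeComparison.map f = D.freeComparison.map g := by
  refine GroupoidRep.hom_ext fun G _ R => ?_
  have hX := relations_of_rep R
  change (R.comp D.freeComparison).val f = (R.comp D.freeComparison).val g
  obtain ⟨t, v⟩ | ⟨f, p, hp⟩ := h
  · rw [GroupoidRep.val_comp, val_freeComparison_map, val_freeComparison_map, GroupoidRep.val_id]
    exact faceVal_back t v
  · obtain ⟨ψ, hψ⟩ := hX.exists_flagPotential hD
    have key : ∀ f g p, D.fourTerm.EdgePath f g p →
        ψ f * (R.comp D.freeComparison).val p = ψ g := by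
      intro f g p hp
      induction hp with
      | nil f => rw [GroupoidRep.val_id, mul_one]
      | cons f g p _ ih =>
        have h := (R.comp D.freeComparison).val_comp (D.fourTerm.freeFace ⟨f.out, rfl⟩) p
        rw [val_freeComparison_map] at h
        rw [← ih, ← hψ f, mul_assoc]
        exact congrArg (ψ f * ·) h
    rw [GroupoidRep.val_id]
    exact mul_eq_left.1 (key f f p hp)

/-- The comparison functor from the fundamental groupoid of the four-term decomposition to the
fundamental groupoid of the diagram. -/
noncomputable def OverAndUnder.comparisonFunctor (hD : D.OverAndUnder) :
    D.fourTerm.FundGroupoid ⥤ D.PathGroupoid :=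
  CategoryTheory.Quotient.lift _ D.freeComparison hD.freeComparison_respects

end LinkDiagram

/-! ### Values of turns in a gluing of tetrahedra -/

namespace TetGluing

variable {T : TetGluing} {G : Type} [Group G]

/-- `Turn U f g x`: rotation around an edge from `f` to `g` has the value `x`, if `U` gives the
values of the passages through faces. -/
inductive Turn (U : T.Tet → IdealVertex → G) : T.Flag → T.Flag → G → Prop
  | nil (f : T.Flag) : Turn U f f 1
  | cons (f g : T.Flag) (x : G) (h : Turn U f.next g x) : Turn U f g (U f.tet f.out * x)

theorem Turn.step {U : T.Tet → IdealVertex → G} {f g : T.Flag} (h : f.next = g) :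
    Turn U f g (U f.tet f.out) := by
  subst h
  simpa using Turn.cons (U := U) f _ 1 (Turn.nil _)

theorem Turn.trans {U : T.Tet → IdealVertex → G} {f g k : T.Flag} {x y : G} (h : Turn U f g x)
    (h' : Turn U g k y) : Turn U f k (x * y) := by
  induction h with
  | nil f => simpa using h'
  | cons f g x _ ih =>
    rw [mul_assoc]
    exact .cons _ _ _ (ih h')

theorem val_freeFace (R : GroupoidRep T.FundGroupoid G) {t t' : T.Tet} (e : T.FaceArrow t t') :
    R.val ((CategoryTheory.Quotient.functor T.DualRel).map (T.freeFace e))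
      = R.val (T.face t e.vertex) := by
  obtain ⟨v, rfl⟩ := e
  rfl

theorem val_back (R : GroupoidRep T.FundGroupoid G) (t : T.Tet) (v : IdealVertex) :
    R.val (T.face t v) * R.val (T.face (T.nbr t v) (T.perm t v v)) = 1 := by
  have := congrArg R.val (CategoryTheory.Quotient.sound _ (DualRel.back t v))
  rwa [CategoryTheory.Functor.map_comp, R.val_comp, val_freeFace, val_freeFace,
    CategoryTheory.Functor.map_id, R.val_id] at this

/-- Partial turns can thus be composed by their values alone; the underlying path is needed only
when a turn closes up, to invoke the edge relation. -/
theorem Turn.exists_edgePath {R : GroupoidRep T.FundGroupoid G} {f g : T.Flag} {x : G}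
    (h : Turn (fun t v => R.val (T.face t v)) f g x) :
    ∃ p, T.EdgePath f g p ∧
      R.val ((CategoryTheory.Quotient.functor T.DualRel).map p) = x := by
  induction h with
  | nil f => exact ⟨_, .nil f, by rw [CategoryTheory.Functor.map_id, R.val_id]⟩
  | cons f g x _ ih =>
    obtain ⟨p, hp, rfl⟩ := ih
    refine ⟨_, .cons f g p hp, ?_⟩
    exact (R.comp (CategoryTheory.Quotient.functor T.DualRel)).val_comp
      (T.freeFace ⟨f.out, rfl⟩) p

theorem Turn.eq_one {R : GroupoidRep T.FundGroupoid G} {f : T.Flag} {x : G}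
    (h : Turn (fun t v => R.val (T.face t v)) f f x) : x = 1 := by
  obtain ⟨p, hp, rfl⟩ := h.exists_edgePath
  rw [CategoryTheory.Quotient.sound _ (DualRel.edge f p hp), CategoryTheory.Functor.map_id,
    R.val_id]

/-- Two representations of the fundamental groupoid agree if they agree on the passages through
faces. -/
theorem val_eq_of_face (R R' : GroupoidRep T.FundGroupoid G)
    (h : ∀ t v, R.val (T.face t v) = R'.val (T.face t v)) {x y : T.FundGroupoid} (f : x ⟶ y) :
    R.val f = R'.val f := by
  obtain ⟨f, rfl⟩ := (CategoryTheory.Quotient.functor T.DualRel).map_surjective (X := x.as)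
    (Y := y.as) f
  refine GroupoidRep.eq_of_eq_on_generators (R.comp (CategoryTheory.Quotient.functor T.DualRel))
    (R'.comp (CategoryTheory.Quotient.functor T.DualRel)) (fun {t t'} e => ?_) f
  exact (val_freeFace R (t := t) (t' := t') e).trans
    ((h _ _).trans (val_freeFace R' (t := t) (t' := t') e).symm)

end TetGluing

/-! ### Turns around a region and the choice of gauge -/

/-- The strand along which one leaves a corner when going around its region with the region on
the left. -/
def Side.exit : Side → Strand
  | .N => .two
  | .W => .one
  | .S => .two
  | .E => .one

namespace CrossingGraph

variable {G : CrossingGraph}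

theorem along_tailCorner (s : G.Segment) (b : Bool) :
    (G.tailCorner s b).along (G.tail s).2 = G.headCorner s b := by
  simp [Corner.along, tailCorner, Corner.segment, Strand.outSide_incoming,
    Strand.outSide_isLeft]

theorem alongStrand_tailCorner (s : G.Segment) (b : Bool) :
    (G.tailCorner s b).alongStrand (G.tail s).2 = (G.head s).2 := by
  simp [Corner.alongStrand, tailCorner, Corner.segment, Strand.outSide_incoming]

theorem along_headCorner (s : G.Segment) (b : Bool) :
    (G.headCorner s b).along (G.head s).2 = G.tailCorner s b := by
  simp [Corner.along, headCorner, Corner.segment, Strand.inSide_incoming,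
    Strand.inSide_isLeft]

theorem alongStrand_headCorner (s : G.Segment) (b : Bool) :
    (G.headCorner s b).alongStrand (G.head s).2 = (G.tail s).2 := by
  simp [Corner.alongStrand, headCorner, Corner.segment, Strand.inSide_incoming]

theorem exit_outSide (k : Strand) : (k.outSide false).exit = k.other := by cases k <;> rfl

theorem exit_inSide (k : Strand) : (k.inSide true).exit = k.other := by cases k <;> rfl

/-- Going around a region one arrives at a corner along one strand and leaves along the other. -/
theorem Corner.exit_along (t : G.Corner) :
    (t.along t.side.exit).side.exit = (t.alongStrand t.side.exit).other := by
  obtain ⟨c, K⟩ := t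
  cases K <;> first | exact exit_outSide _ | exact exit_inSide _

theorem Corner.exit_along_other (t : G.Corner) :
    (t.along t.side.exit.other).side.exit = t.alongStrand t.side.exit.other := by
  have h1 : ∀ k : Strand, (k.outSide true).exit = k := fun k => by cases k <;> rfl
  have h2 : ∀ k : Strand, (k.inSide false).exit = k := fun k => by cases k <;> rfl
  obtain ⟨c, K⟩ := t
  cases K <;> first | exact h1 _ | exact h2 _

/-- Rotation around a region, from each corner to the next. -/
def cornerPerm (G : CrossingGraph) : Equiv.Perm G.Corner where
  toFun t := t.along t.side.exit
  invFun t := t.along t.side.exit.other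
  left_inv t := by
    change (t.along t.side.exit).along (t.along t.side.exit).side.exit.other = t
    rw [Corner.exit_along, _root_.Strand.other_other]
    exact (along_aux t _).1
  right_inv t := by
    change (t.along t.side.exit.other).along (t.along t.side.exit.other).side.exit = t
    rw [Corner.exit_along_other]
    exact (along_aux t _).1

end CrossingGraph

namespace LinkDiagram

variable {D : LinkDiagram} {G : Type} [Group G]

/-- The rotation around the edge `P₋ P₊` of a corner. -/
def regionFlag (t : D.Corner) : D.fourTerm.Flag :=
  ⟨t, .strand t.side.exit.other, .strand t.side.exit, by
    simpa using Strand.other_ne t.side.exit⟩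

/-- Turning around P₋P₊ is thereby the rotation of the corners around their region. -/
theorem regionFlag_next (t : D.Corner) :
    (regionFlag t).next = regionFlag (D.cornerPerm t) := by
  have h0 : D.cornerPerm t = t.along t.side.exit := rfl
  have h1 : D.fourTerm.nbr t (.strand t.side.exit.other) = D.cornerPerm t := by
    change t.along t.side.exit.other.other = _
    rw [Strand.other_other, h0]
  have h2 : D.fourTerm.perm t (.strand t.side.exit.other) (.strand t.side.exit)
      = .strand (D.cornerPerm t).side.exit.other := by
    change strandPerm t.side.exit.other.other (t.alongStrand t.side.exit.other.other) _ = _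
    rw [Strand.other_other, strandPerm_apply, h0, CrossingGraph.Corner.exit_along,
      Strand.other_other]
  have h3 : D.fourTerm.perm t (.strand t.side.exit.other) (.strand t.side.exit.other)
      = .strand (D.cornerPerm t).side.exit := by
    change strandPerm t.side.exit.other.other (t.alongStrand t.side.exit.other.other) _ = _
    rw [Strand.other_other, strandPerm_other, h0, CrossingGraph.Corner.exit_along]
  simp only [TetGluing.Flag.next, regionFlag, h1, h2, h3]

/-- A representation is equivalent to one that is trivial on the passages within regions. -/
theorem exists_gauge (R : GroupoidRep D.fourTerm.FundGroupoid G) :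
    ∃ h : D.fourTerm.FundGroupoid → G,
      ∀ t k, (R.gauge h).val (D.fourTerm.face t (.strand k)) = 1 := by
  let U : D.fourTerm.Tet → IdealVertex → G := fun t v => R.val (D.fourTerm.face t v)
  -- Walks of `cornerPerm` are turns around P₋P₊, so closed walks have value 1 and a potential
  -- exists.
  have hU : ∀ n t, TetGluing.Turn U (regionFlag t) (regionFlag ((D.cornerPerm ^ n) t))
      (D.cornerPerm.walk (fun t : D.Corner => U t (.strand t.side.exit.other)) n t) := by
    intro n
    induction n with
    | zero => exact fun t => .nil _
    | succ n ih =>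
      intro t
      refine .cons _ _ _ ?_
      rw [regionFlag_next, pow_succ, Equiv.Perm.mul_apply]
      exact ih _
  obtain ⟨h, hh⟩ := D.cornerPerm.exists_potential
    (fun t : D.Corner => U t (.strand t.side.exit.other)) (fun n t hn => by
      have := hU n t
      rw [hn] at this
      exact this.eq_one)
  -- A corner has two faces within its region: one leads on to the next corner, the other undoes the
  -- step from the previous one.
  have key : ∀ (t : D.Corner) k, U t (.strand k) = (h t)⁻¹ * h (t.along k.other) := by
    intro t k
    obtain rfl | rfl := Strand.eq_or_eq_other t.side.exit k
    · have h1 := TetGluing.val_back R t (.strand t.side.exit)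
      have h2 := hh (t.along t.side.exit.other)
      have h3 : D.cornerPerm (t.along t.side.exit.other) = t := D.cornerPerm.right_inv t
      have h4 : D.fourTerm.perm t (.strand t.side.exit) (.strand t.side.exit)
          = .strand (t.along t.side.exit.other).side.exit.other := by
        rw [CrossingGraph.Corner.exit_along_other]
        exact (congrArg (fun k => strandPerm t.side.exit.other (t.alongStrand t.side.exit.other)
          (.strand k)) (Strand.other_other t.side.exit).symm).trans (strandPerm_other _ _)
      rw [h4] at h1
      rw [h3] at h2
      rw [h2, _root_.mul_inv_rev, inv_mul_cancel_right]
      exact eq_inv_of_mul_eq_one_left h1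
    · rw [Strand.other_other]
      exact eq_inv_mul_of_mul_eq (hh t).symm
  refine ⟨fun x => h x.as.as, fun t k => ?_⟩
  change h t * U t (.strand k) * (h (t.along k.other))⁻¹ = 1
  exact mul_inv_eq_one.2 (mul_eq_of_eq_inv_mul (key t k))

end LinkDiagram

/-! ### Recovering the generators from a gauge-fixed representation -/

namespace CrossingGraph

variable {G : CrossingGraph}

theorem inSide_across (k : Strand) (b : Bool) : (k.inSide b).across k = k.inSide !b := by
  cases k <;> cases b <;> rfl

theorem outSide_across (k : Strand) (b : Bool) : (k.outSide b).across k = k.outSide !b := by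
  cases k <;> cases b <;> rfl

theorem inSide_across_other (k : Strand) (b : Bool) :
    (k.inSide b).across k.other = k.outSide b := by
  cases k <;> cases b <;> rfl

theorem outSide_across_other (k : Strand) (b : Bool) :
    (k.outSide b).across k.other = k.inSide b := by
  cases k <;> cases b <;> rfl

end CrossingGraph

namespace LinkDiagram

variable {D : LinkDiagram} {G : Type} [Group G]

theorem OverAndUnder.comparisonFunctor_map_face (hD : D.OverAndUnder)
    (R : GroupoidRep D.PathGroupoid G) (t : D.Corner) (v : IdealVertex) :
    R.val (hD.comparisonFunctor.map (D.fourTerm.face t v))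
      = faceVal (fun s ε => R.val (D.segmentPath s ε)) t v :=
  val_freeComparison_map R ⟨v, rfl⟩

/-- The rotation that sets out along a segment on its left side. -/
def leftFlag (s : D.Segment) (ε : Bool) : D.fourTerm.Flag :=
  ⟨D.tailCorner s true, .strand (D.tail s).2.other, .pass ε, IdealVertex.strand_ne_pass _ _⟩

/-- The rotation that comes back along a segment on its right side. -/
def rightFlag (s : D.Segment) (ε : Bool) : D.fourTerm.Flag :=
  ⟨D.tailCorner s false, .pass ε, .strand (D.tail s).2.other,
    (IdealVertex.strand_ne_pass _ _).symm⟩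

theorem leftFlag_next (s : D.Segment) (ε : Bool) :
    (leftFlag s ε).next = ⟨D.headCorner s true, .pass ε, .strand (D.head s).2.other,
      (IdealVertex.strand_ne_pass _ _).symm⟩ := by
  rw [leftFlag, next_strand_pass]
  congr 1
  · exact CrossingGraph.along_tailCorner s true
  · rw [CrossingGraph.alongStrand_tailCorner]

theorem next_eq_rightFlag (s : D.Segment) (ε : Bool) :
    (⟨D.headCorner s false, .strand (D.head s).2.other, .pass ε,
      IdealVertex.strand_ne_pass _ _⟩ : D.fourTerm.Flag).next = rightFlag s ε := by
  rw [rightFlag, next_strand_pass]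
  congr 1
  · exact CrossingGraph.along_headCorner s false
  · rw [CrossingGraph.alongStrand_headCorner]

/-- A representation that is trivial on the passages within regions comes from elements assigned
to the generators of the fundamental groupoid of the diagram. -/
theorem OverAndUnder.exists_relations (hD : D.OverAndUnder)
    (R : GroupoidRep D.fourTerm.FundGroupoid G)
    (hR : ∀ t k, R.val (D.fourTerm.face t (.strand k)) = 1) :
    ∃ X : D.Segment → Bool → G, Relations X ∧
      ∀ t v, R.val (D.fourTerm.face t v) = faceVal X t v := by
  let U : D.fourTerm.Tet → IdealVertex → G := fun t v => R.val (D.fourTerm.face t v)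
  have hstrand : ∀ t k, U t (.strand k) = 1 := hR
  have hback : ∀ c K ε, U ⟨c, K⟩ (.pass ε) * U ⟨c, K.across (D.passStrand c ε)⟩ (.pass ε) = 1 := by
    intro c K ε
    cases ε <;> exact TetGluing.val_back R _ _
  -- If the strand at the head of s is passed there, `X s` is the value of that face. Otherwise one
  -- moves past the crossing on the left side, uses the next segment, and returns on the right side;
  -- this ends since every component is passed somewhere.
  have hX : ∀ ε, ∃ X : D.Segment → G,
      (∀ c k, k = D.passStrand c ε →
        X (D.head.symm (c, k)) = U ⟨c, k.inSide true⟩ (.pass ε)) ∧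
      (∀ c k, k ≠ D.passStrand c ε → X (D.head.symm (c, k)) =
        U ⟨c, k.inSide true⟩ (.pass ε) * X (D.tail.symm (c, k))
          * U ⟨c, k.outSide false⟩ (.pass ε)) := by
    intro ε
    obtain ⟨X, h1, h2⟩ := D.nextSegment.exists_cycle_recursion (hD.exists_pass ε)
      (fun s => U (D.headCorner s true) (.pass ε))
      (fun s x => U (D.headCorner s true) (.pass ε) * x
        * U (D.tailCorner (D.nextSegment s) false) (.pass ε))
    refine ⟨X, fun c k hk => ?_, fun c k hk => ?_⟩
    · rw [h1 _ (by simpa using hk), CrossingGraph.headCorner_symm]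
    · rw [h2 _ (by simpa using hk), CrossingGraph.headCorner_symm, nextSegment_head_symm,
        CrossingGraph.tailCorner_symm]
  choose X hin hstep using hX
  -- By the same recursion, `X ε s` is the value of the part of a turn around P_kP_± that leads from
  -- the left side of s to its right side.
  have hturn : ∀ ε s, TetGluing.Turn U (leftFlag s ε) (rightFlag s ε) (X ε s) := by
    intro ε s
    induction s using D.nextSegment.cycle_induction (hD.exists_pass ε) with
    | start s hs =>
      obtain ⟨⟨c, k⟩, rfl⟩ := D.head.symm.surjective s
      rw [Equiv.apply_symm_apply] at hs
      have h2 := next_pass (D.headCorner (D.head.symm (c, k)) true) ε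
        (.strand (D.head (D.head.symm (c, k))).2.other) (IdealVertex.strand_ne_pass _ _).symm
      have h3 : (D.headCorner (D.head.symm (c, k)) true).across (D.passStrand
          (D.headCorner (D.head.symm (c, k)) true).crossing ε)
            = D.headCorner (D.head.symm (c, k)) false := by
        rw [CrossingGraph.headCorner_symm, CrossingGraph.headCorner_symm, ← hs,
          CrossingGraph.Corner.across, CrossingGraph.inSide_across]
        rfl
      have h := (TetGluing.Turn.step (U := U) (leftFlag_next _ ε)).trans
        ((TetGluing.Turn.step (U := U) (h2.trans (by simp only [h3]))).trans
          (TetGluing.Turn.step (U := U) (next_eq_rightFlag (D.head.symm (c, k)) ε)))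
      convert h using 1
      rw [hin ε c k hs, ← CrossingGraph.headCorner_symm]
      exact ((congrArg₂ (· * ·) (hstrand _ _)
        (congrArg (_ * ·) (hstrand _ _))).trans (by simp)).symm
    | step s hs ih =>
      obtain ⟨⟨c, k⟩, rfl⟩ := D.head.symm.surjective s
      rw [Equiv.apply_symm_apply] at hs
      have hk : D.passStrand c ε = k.other := (Strand.eq_or_eq_other k _).resolve_left (Ne.symm hs)
      rw [nextSegment_head_symm] at ih
      have h2 := next_pass (D.headCorner (D.head.symm (c, k)) true) ε
        (.strand (D.head (D.head.symm (c, k))).2.other) (IdealVertex.strand_ne_pass _ _).symm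
      have h3 : (D.headCorner (D.head.symm (c, k)) true).across (D.passStrand
          (D.headCorner (D.head.symm (c, k)) true).crossing ε)
            = D.tailCorner (D.tail.symm (c, k)) true := by
        rw [CrossingGraph.headCorner_symm, CrossingGraph.tailCorner_symm, hk,
          CrossingGraph.Corner.across, CrossingGraph.inSide_across_other]
      have h4 := next_pass (D.tailCorner (D.tail.symm (c, k)) false) ε
        (.strand (D.tail (D.tail.symm (c, k))).2.other) (IdealVertex.strand_ne_pass _ _).symm
      have h5 : (D.tailCorner (D.tail.symm (c, k)) false).across (D.passStrand
          (D.tailCorner (D.tail.symm (c, k)) false).crossing ε)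
            = D.headCorner (D.head.symm (c, k)) false := by
        rw [CrossingGraph.headCorner_symm, CrossingGraph.tailCorner_symm, hk,
          CrossingGraph.Corner.across, CrossingGraph.outSide_across_other]
      have h := (TetGluing.Turn.step (U := U) (leftFlag_next _ ε)).trans
        ((TetGluing.Turn.step (U := U) (g := leftFlag (D.tail.symm (c, k)) ε)
          (h2.trans (by simp only [h3, leftFlag, Equiv.apply_symm_apply]))).trans
          (ih.trans ((TetGluing.Turn.step (U := U) (f := rightFlag (D.tail.symm (c, k)) ε)
            (h4.trans (by simp only [h5, Equiv.apply_symm_apply]))).trans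
          (TetGluing.Turn.step (U := U) (next_eq_rightFlag (D.head.symm (c, k)) ε)))))
      convert h using 1
      rw [hstep ε c k hs, ← CrossingGraph.headCorner_symm, ← CrossingGraph.tailCorner_symm,
        mul_assoc]
      exact ((congrArg₂ (· * ·) (hstrand _ _) (congrArg (_ * ·) (congrArg (_ * ·)
        (congrArg (_ * ·) (hstrand _ _))))).trans (by rw [one_mul, mul_one]; rfl)).symm
  -- If the strand is passed at the tail as well, crossing back there completes the partial turn to
  -- a full one. This compares `X` with the face at the tail.
  have hout : ∀ ε c k, k = D.passStrand c ε →
      X ε (D.tail.symm (c, k)) = U ⟨c, k.outSide true⟩ (.pass ε) := by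
    intro ε c k hk
    have h1 := next_pass (D.tailCorner (D.tail.symm (c, k)) false) ε
      (.strand (D.tail (D.tail.symm (c, k))).2.other) (IdealVertex.strand_ne_pass _ _).symm
    have h2 : (D.tailCorner (D.tail.symm (c, k)) false).across (D.passStrand
        (D.tailCorner (D.tail.symm (c, k)) false).crossing ε)
          = D.tailCorner (D.tail.symm (c, k)) true := by
      rw [CrossingGraph.tailCorner_symm, CrossingGraph.tailCorner_symm, ← hk,
        CrossingGraph.Corner.across, CrossingGraph.outSide_across]
      rfl
    have h3 := ((hturn ε (D.tail.symm (c, k))).trans (TetGluing.Turn.step (U := U)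
      (f := rightFlag (D.tail.symm (c, k)) ε) (g := leftFlag (D.tail.symm (c, k)) ε)
      (h1.trans (by simp only [h2]; rfl)))).eq_one
    have h4 : U ⟨c, k.outSide true⟩ (.pass ε) * U ⟨c, k.outSide false⟩ (.pass ε) = 1 := by
      have := hback c (k.outSide true) ε
      rwa [← hk, CrossingGraph.outSide_across] at this
    rw [eq_inv_of_mul_eq_one_left h4]
    refine eq_inv_of_mul_eq_one_left (Eq.trans ?_ h3)
    rw [← CrossingGraph.tailCorner_symm]
    rfl
  have hcross : ∀ (t : D.Corner) ε, U t (.pass ε)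
      = crossVal (fun s ε => X ε s) t (D.passStrand t.crossing ε) ε := by
    rintro ⟨c, K⟩ ε
    generalize hk : D.passStrand c ε = k
    have hb := hback c K ε
    have h1 := hin ε c k hk.symm
    have h2 := hout ε c k hk.symm
    rw [hk] at hb
    cases k <;> cases K
    · exact h1.symm
    · exact (eq_inv_of_mul_eq_one_left hb).trans (congrArg _ h1.symm)
    · exact (eq_inv_of_mul_eq_one_left hb).trans (congrArg _ h2.symm)
    · exact h2.symm
    · exact h2.symm
    · exact h1.symm
    · exact (eq_inv_of_mul_eq_one_left hb).trans (congrArg _ h1.symm)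
    · exact (eq_inv_of_mul_eq_one_left hb).trans (congrArg _ h2.symm)
  have hface : ∀ (t : D.Corner) v, U t v = faceVal (fun s ε => X ε s) t v := by
    intro t v
    obtain ⟨k, rfl⟩ | ⟨ε, rfl⟩ := IdealVertex.strand_or_pass v
    · exact hstrand t k
    · rw [faceVal_pass, hcross]
  -- Written in terms of `X` alone, the recursion is the relation for passing both strands on the
  -- same side.
  have hslide : ∀ ε c k, k ≠ D.passStrand c ε → X ε (D.head.symm (c, k)) =
      crossVal (fun s ε => X ε s) ⟨c, k.inSide true⟩ k.other ε * X ε (D.tail.symm (c, k))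
        * crossVal (fun s ε => X ε s) ⟨c, k.outSide false⟩ k.other ε := by
    intro ε c k hk
    have h := hstep ε c k hk
    rw [hcross, hcross] at h
    rwa [show D.passStrand c ε = k.other from
      (Strand.eq_or_eq_other k _).resolve_left (Ne.symm hk)] at h
  -- The full turn around P₁P₂ has four passages, alternately through P₁P₂P₊ and P₁P₂P₋; it gives
  -- the relation for passing between the strands.
  have hfour : ∀ c ε ε', ε ≠ ε' → U ⟨c, .N⟩ (.pass ε) *
      (U ((⟨c, .N⟩ : D.Corner).across (D.passStrand c ε)) (.pass ε') *
      (U (((⟨c, .N⟩ : D.Corner).across (D.passStrand c ε)).across (D.passStrand c ε')) (.pass ε) *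
      U ((((⟨c, .N⟩ : D.Corner).across (D.passStrand c ε)).across (D.passStrand c ε')).across
        (D.passStrand c ε)) (.pass ε'))) = 1 := by
    intro c ε ε' hε
    have hne : IdealVertex.pass ε ≠ IdealVertex.pass ε' := by
      cases ε <;> cases ε' <;> simp_all [IdealVertex.pass]
    refine ((TetGluing.Turn.step (U := U) (next_pass ⟨c, .N⟩ ε _ hne)).trans
      ((TetGluing.Turn.step (U := U) (next_pass _ ε' _ hne.symm)).trans
      ((TetGluing.Turn.step (U := U) (next_pass _ ε _ hne)).trans
      (TetGluing.Turn.step (U := U) ((next_pass _ ε' _ hne.symm).trans ?_))))).eq_one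
    have h6 : ∀ k k' : Strand, k ≠ k' →
        (((Side.N.across k).across k').across k).across k' = .N := by
      intro k k' h
      cases k <;> cases k' <;> simp_all [Side.across]
    have h7 : D.passStrand c ε ≠ D.passStrand c ε' := by
      cases ε <;> cases ε' <;> simp_all [passStrand, CrossingGraph.underStrand]
      · exact (Strand.other_ne _).symm
      · exact Strand.other_ne _
    have h8 := h6 _ _ h7
    simp only [CrossingGraph.Corner.across, h8]
  refine ⟨fun s ε => X ε s, ⟨fun c ε => ?_, fun c h => ?_, fun c h => ?_⟩, hface⟩
  · have h := hslide ε c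
    generalize D.passStrand c ε = k at h
    cases k
    · have h2 : X ε (D.s₂ c) = (X ε (D.s₁ c))⁻¹ * X ε (D.s₂' c) * X ε (D.s₁' c) :=
        h .two (by decide)
      rw [h2, mul_assoc, mul_inv_cancel_left]
    · have h1 : X ε (D.s₁ c) = X ε (D.s₂' c) * X ε (D.s₁' c) * (X ε (D.s₂ c))⁻¹ :=
        h .one (by decide)
      rw [h1, inv_mul_cancel_right]
  · have h4 := hfour c false true (by decide)
    simp only [hcross] at h4
    have h1 : D.passStrand c false = .one := by simp [passStrand, CrossingGraph.overStrand, h]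
    have h2 : D.passStrand c true = .two := by
      simp [passStrand, CrossingGraph.underStrand, CrossingGraph.overStrand, h, Strand.other]
    simp only [CrossingGraph.Corner.across, h1, h2] at h4
    change X false (D.s₁ c) * (X true (D.s₂ c) * ((X false (D.s₁' c))⁻¹ * (X true (D.s₂' c))⁻¹))
      = 1 at h4
    rwa [← mul_assoc, ← _root_.mul_inv_rev, mul_inv_eq_one] at h4
  · have h4 := hfour c true false (by decide)
    simp only [hcross] at h4
    have h1 : D.passStrand c false = .two := by simp [passStrand, CrossingGraph.overStrand, h]
    have h2 : D.passStrand c true = .one := by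
      simp [passStrand, CrossingGraph.underStrand, CrossingGraph.overStrand, h, Strand.other]
    simp only [CrossingGraph.Corner.across, h1, h2] at h4
    change X true (D.s₁ c) * (X false (D.s₂ c) * ((X true (D.s₁' c))⁻¹ * (X false (D.s₂' c))⁻¹))
      = 1 at h4
    rwa [← mul_assoc, ← _root_.mul_inv_rev, mul_inv_eq_one] at h4

end LinkDiagram

/-! ### The comparison functor is an equivalence -/

namespace LinkDiagram

variable {D : LinkDiagram}

/-- Every representation of the source is, up to gauge, pulled back from the target, so none of them
separates two morphisms with the same image. -/
theorem OverAndUnder.comparisonFunctor_faithful (hD : D.OverAndUnder) :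
    hD.comparisonFunctor.Faithful where
  map_injective {x y f g} hfg := by
    refine GroupoidRep.hom_ext fun G _ R => ?_
    obtain ⟨h, hh⟩ := exists_gauge R
    obtain ⟨X, hX, hface⟩ := hD.exists_relations (R.gauge h) hh
    have key : ∀ {x y : D.fourTerm.FundGroupoid} (f : x ⟶ y),
        (R.gauge h).val f = ((pathRep X hX).comp hD.comparisonFunctor).val f := by
      intro x y f
      refine TetGluing.val_eq_of_face _ _ (fun t v => ?_) f
      rw [hface]
      refine Eq.trans ?_ (hD.comparisonFunctor_map_face (pathRep X hX) t v).symm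
      congr
      funext s ε
      exact (pathRep_gen X hX ⟨s, ε, rfl, rfl⟩).symm
    have h1 : (R.gauge h).val f = (R.gauge h).val g := by
      rw [key, key]
      exact congrArg (pathRep X hX).val hfg
    exact mul_left_cancel (mul_right_cancel h1)

/-- There is a morphism of the fundamental groupoid of the four-term decomposition on whose image
all representations take the values `v`. -/
def OverAndUnder.Realizes (hD : D.OverAndUnder) (t t' : D.Corner)
    (v : ∀ {G : Type} [Group G], (D.Segment → Bool → G) → G) : Prop :=
  ∃ γ : D.fourTerm.obj t ⟶ D.fourTerm.obj t', ∀ (G : Type) [Group G]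
    (R : GroupoidRep D.PathGroupoid G),
      R.val (hD.comparisonFunctor.map γ) = v (fun s ε => R.val (D.segmentPath s ε))

theorem OverAndUnder.Realizes.trans {hD : D.OverAndUnder} {t t' t'' : D.Corner}
    {v w : ∀ {G : Type} [Group G], (D.Segment → Bool → G) → G} (h : hD.Realizes t t' v)
    (h' : hD.Realizes t' t'' w) : hD.Realizes t t'' (fun X => v X * w X) := by
  obtain ⟨γ, hγ⟩ := h
  obtain ⟨δ, hδ⟩ := h'
  refine ⟨γ ≫ δ, fun G _ R => ?_⟩
  rw [CategoryTheory.Functor.map_comp, R.val_comp, hγ, hδ]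

theorem OverAndUnder.Realizes.inv {hD : D.OverAndUnder} {t t' : D.Corner}
    {v : ∀ {G : Type} [Group G], (D.Segment → Bool → G) → G} (h : hD.Realizes t t' v) :
    hD.Realizes t' t (fun X => (v X)⁻¹) := by
  obtain ⟨γ, hγ⟩ := h
  refine ⟨Groupoid.inv γ, fun G _ R => ?_⟩
  have := (R.comp hD.comparisonFunctor).val_inv γ
  exact this.trans (congrArg _ (hγ G R))

theorem OverAndUnder.Realizes.along (hD : D.OverAndUnder) (t : D.Corner) (k : Strand) :
    hD.Realizes t (t.along k) (fun _ => 1) := by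
  have : hD.Realizes t (t.along k.other.other) (fun _ => 1) :=
    ⟨D.fourTerm.face t (.strand k.other), fun G _ R => hD.comparisonFunctor_map_face R t _⟩
  rwa [Strand.other_other] at this

theorem OverAndUnder.Realizes.across (hD : D.OverAndUnder) (t : D.Corner) (k : Strand) (ε : Bool)
    (hk : k = D.passStrand t.crossing ε) :
    hD.Realizes t (t.across k) (fun X => crossVal X t k ε) := by
  subst hk
  rw [← fourTermNbr_pass]
  refine ⟨D.fourTerm.face t (.pass ε), fun G _ R => ?_⟩
  exact (hD.comparisonFunctor_map_face R t _).trans (faceVal_pass _ t ε)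

/-- Each pair of corners generating the equivalence relation of regions shares a face containing P₋
and P₊. -/
theorem OverAndUnder.Realizes.of_region_eq (hD : D.OverAndUnder) {t t' : D.Corner}
    (h : t.region = t'.region) : hD.Realizes t t' (fun _ => 1) := by
  have h' := Quot.eqvGen_exact h
  clear h
  induction h' with
  | rel t t' h =>
    obtain ⟨s, b⟩ := h
    have := Realizes.along hD (D.tailCorner s b) (D.tail s).2
    rwa [CrossingGraph.along_tailCorner] at this
  | refl t => exact ⟨𝟙 _, fun G _ R => (R.comp hD.comparisonFunctor).val_id _⟩
  | symm t t' h ih => simpa using ih.inv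
  | trans t t' t'' h h' ih ih' =>
    simpa using ih.trans ih'

theorem crossVal_inSide {G : Type} [Group G] (X : D.Segment → Bool → G) (c : D.Crossing)
    (k : Strand) (ε : Bool) :
    crossVal X ⟨c, k.inSide true⟩ k ε = X (D.head.symm (c, k)) ε := by
  cases k <;> rfl

/-- Cross the strand at the head of the segment if it is passed there; otherwise slide past the
crossing to the next segment and come back, which has the right value by `Relations.slide`. -/
theorem OverAndUnder.Realizes.segment (hD : D.OverAndUnder) (ε : Bool) (s : D.Segment) :
    hD.Realizes (D.tailCorner s true) (D.tailCorner s false) (fun X => X s ε) := by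
  have hl : ∀ s b, hD.Realizes (D.tailCorner s b) (D.headCorner s b) (fun _ => 1) :=
    fun s b => of_region_eq hD (CrossingGraph.region_headCorner s b).symm
  induction s using D.nextSegment.cycle_induction (hD.exists_pass ε) with
  | start s hs =>
    obtain ⟨⟨c, k⟩, rfl⟩ := D.head.symm.surjective s
    rw [Equiv.apply_symm_apply] at hs
    have h := across hD ⟨c, k.inSide true⟩ k ε hs
    rw [CrossingGraph.Corner.across, CrossingGraph.inSide_across] at h
    have hl' := hl (D.head.symm (c, k))
    simp only [CrossingGraph.headCorner_symm] at hl'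
    obtain ⟨γ, hγ⟩ := (hl' true).trans (h.trans (hl' false).inv)
    refine ⟨γ, fun G _ R => (hγ G R).trans ?_⟩
    dsimp only
    rw [inv_one, mul_one, one_mul, crossVal_inSide]
  | step s hs ih =>
    obtain ⟨⟨c, k⟩, rfl⟩ := D.head.symm.surjective s
    rw [nextSegment_head_symm, CrossingGraph.tailCorner_symm, CrossingGraph.tailCorner_symm] at ih
    rw [Equiv.apply_symm_apply] at hs
    have hk : k.other = D.passStrand c ε := ((Strand.eq_or_eq_other k _).resolve_left (Ne.symm hs)).symm
    have h : ∀ b, hD.Realizes ⟨c, k.inSide b⟩ ⟨c, k.outSide b⟩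
        (fun X => crossVal X ⟨c, k.inSide b⟩ k.other ε) := fun b => by
      have := across hD ⟨c, k.inSide b⟩ k.other ε hk
      rwa [CrossingGraph.Corner.across, CrossingGraph.inSide_across_other] at this
    have hl' := hl (D.head.symm (c, k))
    simp only [CrossingGraph.headCorner_symm] at hl'
    obtain ⟨γ, hγ⟩ := (hl' true).trans ((h true).trans
      (ih.trans ((h false).inv.trans (hl' false).inv)))
    refine ⟨γ, fun G _ R => (hγ G R).trans ?_⟩
    have := (relations_of_rep R).slide c k ε
    dsimp only
    rw [inv_one, mul_one, one_mul, ← mul_assoc, ← this, mul_inv_cancel_right]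

theorem exists_corner (x : D.PathGroupoid) : ∃ t : D.Corner, D.obj t.region = x := by
  obtain ⟨⟨r⟩⟩ := x
  obtain ⟨t, rfl⟩ := Quot.exists_rep r
  exact ⟨t, rfl⟩

/-- The end corners are arbitrary within their regions, which lets the pieces of a word be joined at
any corner of the intermediate region. -/
theorem OverAndUnder.Realizes.of_hom (hD : D.OverAndUnder) {x y : D.FreePaths} (f : x ⟶ y)
    (t t' : D.Corner) (ht : D.freeObj t.region = x) (ht' : D.freeObj t'.region = y) :
    ∃ γ : D.fourTerm.obj t ⟶ D.fourTerm.obj t', ∀ (G : Type) [Group G]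
      (R : GroupoidRep D.PathGroupoid G), R.val (hD.comparisonFunctor.map γ)
        = (R.comp (CategoryTheory.Quotient.functor D.CrossingRel)).val f := by
  have hinj : ∀ {r r' : D.Region}, D.freeObj r = D.freeObj r' → r = r' :=
    fun h => congrArg (fun x : D.FreePaths => x.as) h
  induction f using Quiver.FreeGroupoid.hom_induction generalizing t t' with
  | id x =>
    obtain ⟨γ, hγ⟩ := of_region_eq hD (hinj (ht.trans ht'.symm))
    refine ⟨γ, fun G _ R => (hγ G R).trans ?_⟩
    rw [GroupoidRep.val_id]
  | of e =>
    obtain ⟨s, ε, rfl, rfl⟩ := e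
    obtain ⟨γ, hγ⟩ := (of_region_eq hD (t := t) (t' := D.tailCorner s true)
      (hinj ht)).trans ((segment hD ε s).trans
      (of_region_eq hD (t := D.tailCorner s false) (t' := t') (hinj ht').symm))
    refine ⟨γ, fun G _ R => (hγ G R).trans ?_⟩
    dsimp only
    rw [one_mul, mul_one]
    rfl
  | inv f ih =>
    obtain ⟨γ, hγ⟩ := ih t' t ht' ht
    refine ⟨Groupoid.inv γ, fun G _ R => ?_⟩
    rw [GroupoidRep.val_inv]
    exact ((R.comp hD.comparisonFunctor).val_inv γ).trans (congrArg _ (hγ G R))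
  | comp f g hf hg =>
    rename_i x y z
    obtain ⟨t'', ht''⟩ : ∃ t'' : D.Corner, D.freeObj t''.region = y := by
      obtain ⟨r⟩ := y
      obtain ⟨t, rfl⟩ := Quot.exists_rep r
      exact ⟨t, rfl⟩
    obtain ⟨γ, hγ⟩ := hf t t'' ht ht''
    obtain ⟨δ, hδ⟩ := hg t'' t' ht'' ht'
    refine ⟨γ ≫ δ, fun G _ R => ?_⟩
    rw [CategoryTheory.Functor.map_comp, R.val_comp, hγ, hδ, GroupoidRep.val_comp]

/-- For fullness a path with the right values in all representations suffices, since these values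
determine its image. -/
theorem OverAndUnder.comparisonFunctor_isEquivalence (hD : D.OverAndUnder) :
    hD.comparisonFunctor.IsEquivalence where
  faithful := hD.comparisonFunctor_faithful
  full := ⟨fun {t t'} f => by
    obtain ⟨f, rfl⟩ := (CategoryTheory.Quotient.functor D.CrossingRel).map_surjective
      (X := (hD.comparisonFunctor.obj t).as) (Y := (hD.comparisonFunctor.obj t').as) f
    obtain ⟨γ, hγ⟩ := Realizes.of_hom hD f t.as.as t'.as.as rfl rfl
    exact ⟨γ, GroupoidRep.hom_ext hγ⟩⟩
  essSurj := ⟨fun x => by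
    obtain ⟨t, ht⟩ := exists_corner x
    exact ⟨D.fourTerm.obj t, ⟨eqToIso ht⟩⟩⟩

end LinkDiagram

/-! ### PSL₂(ℂ) and the Riemann sphere -/

section ProjectiveLine

/-- The center consists of the scalar matrices, and comparing determinants makes any factor of
proportionality a square root of 1. -/
theorem mk_eq_mk_iff (A A' : SL(2, ℂ)) :
    (QuotientGroup.mk A : PSL(2, ℂ)) = QuotientGroup.mk A' ↔
      ∃ c : ℂ, (A' : Matrix (Fin 2) (Fin 2) ℂ) = c • (A : Matrix (Fin 2) (Fin 2) ℂ) := by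
  rw [QuotientGroup.eq, Matrix.SpecialLinearGroup.mem_center_iff]
  constructor
  · rintro ⟨r, -, hr⟩
    refine ⟨r, ?_⟩
    have h : A' = A * (A⁻¹ * A') := by group
    rw [h, Matrix.SpecialLinearGroup.coe_mul, ← hr]
    ext i j
    simp [mul_comm]
  · rintro ⟨c, hc⟩
    have h : ((A⁻¹ * A' : SL(2, ℂ)) : Matrix (Fin 2) (Fin 2) ℂ) = scalar (Fin 2) c := by
      rw [Matrix.SpecialLinearGroup.coe_mul, hc, Matrix.mul_smul, ← Matrix.SpecialLinearGroup.coe_mul,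
        inv_mul_cancel, Matrix.SpecialLinearGroup.coe_one, smul_one_eq_diagonal]
      rfl
    refine ⟨c, ?_, h.symm⟩
    have hd := (A⁻¹ * A').det_coe
    rw [h] at hd
    simpa [pow_two] using hd

/-- Divide by a square root of the determinant. -/
theorem GL.exists_isClassOf (M : GL (Fin 2) ℂ) : ∃ g : PSL(2, ℂ), IsClassOf M g := by
  obtain ⟨c, hc⟩ := IsAlgClosed.exists_pow_nat_eq (M : Matrix (Fin 2) (Fin 2) ℂ).det
    (n := 2) (by norm_num)
  have hM : (M : Matrix (Fin 2) (Fin 2) ℂ).det ≠ 0 :=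
    ((Matrix.isUnit_iff_isUnit_det _).1 M.isUnit).ne_zero
  have hc0 : c ≠ 0 := fun h => hM (by rw [← hc, h]; simp)
  refine ⟨QuotientGroup.mk ⟨c⁻¹ • (M : Matrix (Fin 2) (Fin 2) ℂ), ?_⟩, _, c, rfl, ?_⟩
  · rw [Matrix.det_smul, ← hc, Fintype.card_fin, ← mul_pow, inv_mul_cancel₀ hc0, one_pow]
  · simp [smul_smul, hc0]

theorem IsClassOf.ne_zero {M : GL (Fin 2) ℂ} {A : SL(2, ℂ)} {c : ℂ}
    (h : (M : Matrix (Fin 2) (Fin 2) ℂ) = c • (A : Matrix (Fin 2) (Fin 2) ℂ)) : c ≠ 0 := by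
  rintro rfl
  have hM : (M : Matrix (Fin 2) (Fin 2) ℂ).det ≠ 0 :=
    ((Matrix.isUnit_iff_isUnit_det _).1 M.isUnit).ne_zero
  apply hM
  rw [h, zero_smul]
  simp

theorem IsClassOf.unique {M : GL (Fin 2) ℂ} {g g' : PSL(2, ℂ)} (h : IsClassOf M g)
    (h' : IsClassOf M g') : g = g' := by
  obtain ⟨A, c, rfl, hc⟩ := h
  obtain ⟨A', c', rfl, hc'⟩ := h'
  rw [mk_eq_mk_iff]
  refine ⟨c'⁻¹ * c, ?_⟩
  rw [mul_smul, ← hc, hc', inv_smul_smul₀ (IsClassOf.ne_zero hc')]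

theorem IsClassOf.mul {M M' : GL (Fin 2) ℂ} {g g' : PSL(2, ℂ)} (h : IsClassOf M g)
    (h' : IsClassOf M' g') : IsClassOf (M * M') (g * g') := by
  obtain ⟨A, c, rfl, hc⟩ := h
  obtain ⟨A', c', rfl, hc'⟩ := h'
  refine ⟨A * A', c * c', rfl, ?_⟩
  rw [Units.val_mul, hc, hc', Matrix.SpecialLinearGroup.coe_mul, smul_mul_smul_comm]

/-- The projection `GL₂(ℂ) → PGL₂(ℂ) = PSL₂(ℂ)`. -/
noncomputable def GL.toPSL : GL (Fin 2) ℂ →* PSL(2, ℂ) :=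
  MonoidHom.mk' (fun M => (GL.exists_isClassOf M).choose) fun M M' =>
    (GL.exists_isClassOf (M * M')).choose_spec.unique
      ((GL.exists_isClassOf M).choose_spec.mul (GL.exists_isClassOf M').choose_spec)

theorem GL.isClassOf_toPSL (M : GL (Fin 2) ℂ) : IsClassOf M (GL.toPSL M) :=
  (GL.exists_isClassOf M).choose_spec

/-- Homogeneous coordinates on the Riemann sphere. -/
def homCoord (z : OnePoint ℂ) : Fin 2 → ℂ :=
  z.elim ![1, 0] (fun w => ![w, 1])

/-- In homogeneous coordinates the right action is multiplication of row vectors by `M`. This frees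
the arguments on products, inverses and scalars from case distinctions at ∞. -/
theorem rightMobius_eq_iff {M : Matrix (Fin 2) (Fin 2) ℂ} (hM : M.det ≠ 0) (z w : OnePoint ℂ) :
    rightMobius M z = w ↔ ∃ c : ℂ, c ≠ 0 ∧ homCoord z ᵥ* M = c • homCoord w := by
  rw [Matrix.det_fin_two] at hM
  have hv : ∀ x y c : ℂ, ∀ w, ![x, y] ᵥ* M = c • homCoord w ↔
      x * M 0 0 + y * M 1 0 = c * homCoord w 0 ∧ x * M 0 1 + y * M 1 1 = c * homCoord w 1 := by
    intro x y c w
    rw [funext_iff, Fin.forall_fin_two]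
    simp [Matrix.vecMul, dotProduct, Fin.sum_univ_two]
  have key : ∀ x y : ℂ, (x ≠ 0 ∨ y ≠ 0) → ((if x * M 0 1 + y * M 1 1 = 0 then OnePoint.infty else
      (((x * M 0 0 + y * M 1 0) / (x * M 0 1 + y * M 1 1) : ℂ) : OnePoint ℂ)) = w ↔
      ∃ c : ℂ, c ≠ 0 ∧ ![x, y] ᵥ* M = c • homCoord w) := by
    intro x y hxy
    simp only [hv]
    generalize hp : x * M 0 0 + y * M 1 0 = p
    generalize hq : x * M 0 1 + y * M 1 1 = q
    -- An invertible matrix does not kill a nonzero vector.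
    have hpq : p ≠ 0 ∨ q ≠ 0 := by
      by_contra! h
      obtain ⟨rfl, rfl⟩ := h
      have h1 : x * (M 0 0 * M 1 1 - M 0 1 * M 1 0) = 0 := by
        linear_combination M 1 1 * hp - M 1 0 * hq
      have h2 : y * (M 0 0 * M 1 1 - M 0 1 * M 1 0) = 0 := by
        linear_combination M 0 0 * hq - M 0 1 * hp
      rcases hxy with h | h
      · exact (mul_ne_zero h hM) h1
      · exact (mul_ne_zero h hM) h2
    induction w using OnePoint.rec with
    | infty =>
      by_cases hq0 : q = 0
      · simp only [hq0, if_true, true_iff]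
        exact ⟨p, by simpa [hq0] using hpq, by simp [homCoord]⟩
      · simp [hq0, homCoord]
    | coe w =>
      by_cases hq0 : q = 0
      · simp only [hq0, if_true]
        refine iff_of_false (OnePoint.infty_ne_coe w) ?_
        rintro ⟨c, hc, -, h⟩
        simp [homCoord] at h
        exact hc h.symm
      · simp only [hq0, if_false, OnePoint.coe_eq_coe]
        rw [div_eq_iff hq0]
        constructor
        · rintro h
          exact ⟨q, hq0, by simp [homCoord, h, mul_comm], by simp [homCoord]⟩
        · rintro ⟨c, hc, h1, h2⟩
          simp [homCoord] at h1 h2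
          rw [h1, h2, mul_comm]
  induction z using OnePoint.rec with
  | infty =>
    have h := key 1 0 (by simp)
    simp only [one_mul, zero_mul, add_zero] at h
    exact h
  | coe z =>
    have h := key z 1 (by simp)
    simp only [one_mul, mul_comm z] at h
    exact h

theorem GL.det_coe_ne_zero (M : GL (Fin 2) ℂ) : (M : Matrix (Fin 2) (Fin 2) ℂ).det ≠ 0 :=
  ((Matrix.isUnit_iff_isUnit_det _).1 M.isUnit).ne_zero

theorem rightMobius_inv (M : GL (Fin 2) ℂ) {z w : OnePoint ℂ}
    (h : rightMobius (M : Matrix (Fin 2) (Fin 2) ℂ) z = w) :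
    rightMobius ((M⁻¹ : GL (Fin 2) ℂ) : Matrix (Fin 2) (Fin 2) ℂ) w = z := by
  rw [rightMobius_eq_iff (GL.det_coe_ne_zero _)] at h ⊢
  obtain ⟨c, hc, h⟩ := h
  refine ⟨c⁻¹, inv_ne_zero hc, ?_⟩
  have h1 := congrArg (c⁻¹ • · ᵥ* ((M⁻¹ : GL (Fin 2) ℂ) : Matrix (Fin 2) (Fin 2) ℂ)) h
  simp only [Matrix.vecMul_vecMul, Matrix.smul_vecMul, inv_smul_smul₀ hc] at h1
  rw [← h1, ← Units.val_mul, mul_inv_cancel, Units.val_one, Matrix.vecMul_one]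

theorem rightMobius_mul (M N : GL (Fin 2) ℂ) (z : OnePoint ℂ) :
    rightMobius ((M * N : GL (Fin 2) ℂ) : Matrix (Fin 2) (Fin 2) ℂ) z
      = rightMobius (N : Matrix (Fin 2) (Fin 2) ℂ)
        (rightMobius (M : Matrix (Fin 2) (Fin 2) ℂ) z) := by
  obtain ⟨c, hc, h⟩ := (rightMobius_eq_iff (GL.det_coe_ne_zero M) z _).1 rfl
  obtain ⟨d, hd, h'⟩ := (rightMobius_eq_iff (GL.det_coe_ne_zero N)
    (rightMobius (M : Matrix (Fin 2) (Fin 2) ℂ) z) _).1 rfl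
  rw [rightMobius_eq_iff (GL.det_coe_ne_zero _)]
  refine ⟨c * d, mul_ne_zero hc hd, ?_⟩
  rw [Units.val_mul, ← Matrix.vecMul_vecMul, h, Matrix.smul_vecMul, h', smul_smul]

theorem rightMobius_smul {c : ℂ} (hc : c ≠ 0) {M : Matrix (Fin 2) (Fin 2) ℂ} (hM : M.det ≠ 0)
    (z : OnePoint ℂ) : rightMobius (c • M) z = rightMobius M z := by
  have hM' : (c • M).det ≠ 0 := by
    rw [Matrix.det_smul]
    exact mul_ne_zero (pow_ne_zero _ hc) hM
  obtain ⟨d, hd, h⟩ := (rightMobius_eq_iff hM z _).1 rfl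
  rw [rightMobius_eq_iff hM']
  refine ⟨c * d, mul_ne_zero hc hd, ?_⟩
  rw [Matrix.vecMul_smul, h, smul_smul]

/-- Scalars act trivially, so any representing matrix decides where a point is carried. -/
theorem IsClassOf.carries_iff {M : GL (Fin 2) ℂ} {g : PSL(2, ℂ)} (h : IsClassOf M g)
    (z w : OnePoint ℂ) :
    Carries g z w ↔ rightMobius (M : Matrix (Fin 2) (Fin 2) ℂ) z = w := by
  have key : ∀ (A : SL(2, ℂ)) (c : ℂ), (M : Matrix (Fin 2) (Fin 2) ℂ) = c • (A : Matrix _ _ ℂ) →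
      rightMobius (M : Matrix (Fin 2) (Fin 2) ℂ) z
        = rightMobius (A : Matrix (Fin 2) (Fin 2) ℂ) z := by
    intro A c hc
    rw [hc, rightMobius_smul (IsClassOf.ne_zero hc) (by simp)]
  obtain ⟨A, c, rfl, hc⟩ := h
  rw [key A c hc]
  refine ⟨?_, fun h => ⟨A, rfl, h⟩⟩
  rintro ⟨A', hA, h⟩
  obtain ⟨d, hd⟩ := (mk_eq_mk_iff A' A).1 hA
  rw [← key A c hc, key A' (c * d) (by rw [hc, hd, smul_smul])]
  exact h

theorem toPSL_carries_iff (M : GL (Fin 2) ℂ) (z w : OnePoint ℂ) :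
    Carries (GL.toPSL M) z w ↔ rightMobius (M : Matrix (Fin 2) (Fin 2) ℂ) z = w :=
  (GL.isClassOf_toPSL M).carries_iff z w

/-- A fractional linear transformation with three fixed points is the identity. -/
theorem scalar_of_fixed_points {M : Matrix (Fin 2) (Fin 2) ℂ} (hM : M.det ≠ 0)
    {x y z : OnePoint ℂ} (hxy : x ≠ y) (hxz : x ≠ z) (hyz : y ≠ z) (hx : rightMobius M x = x)
    (hy : rightMobius M y = y) (hz : rightMobius M z = z) :
    M = M 0 0 • (1 : Matrix (Fin 2) (Fin 2) ℂ) := by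
  have hinf : rightMobius M OnePoint.infty = OnePoint.infty → M 0 1 = 0 := by
    intro h
    obtain ⟨c, hc, h⟩ := (rightMobius_eq_iff hM _ _).1 h
    simpa [homCoord, Matrix.vecMul, dotProduct] using congrFun h 1
  -- Finite fixed points are roots of a polynomial of degree at most two, and ∞ is fixed only if its
  -- leading coefficient vanishes.
  have hcoe : ∀ w : ℂ, rightMobius M w = w →
      M 1 0 + (M 0 0 - M 1 1) * w - M 0 1 * w ^ 2 = 0 := by
    intro w h
    obtain ⟨c, hc, h⟩ := (rightMobius_eq_iff hM _ _).1 h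
    have h0 := congrFun h 0
    have h1 := congrFun h 1
    simp [homCoord, Matrix.vecMul, dotProduct] at h0 h1
    linear_combination h0 - w * h1
  have main : M 0 1 = 0 ∧ M 0 0 - M 1 1 = 0 ∧ M 1 0 = 0 := by
    have two : ∀ u v : ℂ, u ≠ v → M 0 1 = 0 → rightMobius M u = u → rightMobius M v = v →
        M 0 1 = 0 ∧ M 0 0 - M 1 1 = 0 ∧ M 1 0 = 0 := by
      intro u v huv h hu hv
      have hu := hcoe u hu
      have hv := hcoe v hv
      rw [h] at hu hv
      have h1 : M 0 0 - M 1 1 = 0 := by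
        refine (mul_eq_zero.1 (?_ : (M 0 0 - M 1 1) * (u - v) = 0)).resolve_right
          (sub_ne_zero.2 huv)
        linear_combination hu - hv
      refine ⟨h, h1, ?_⟩
      rw [h1] at hu
      linear_combination hu
    induction x using OnePoint.rec with
    | infty =>
      induction y using OnePoint.rec with
      | infty => exact absurd rfl hxy
      | coe y =>
        induction z using OnePoint.rec with
        | infty => exact absurd rfl hxz
        | coe z => exact two y z (fun h => hyz (congrArg _ h)) (hinf hx) hy hz
    | coe x =>
      induction y using OnePoint.rec with
      | infty =>
        induction z using OnePoint.rec with
        | infty => exact absurd rfl hyz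
        | coe z => exact two x z (fun h => hxz (congrArg _ h)) (hinf hy) hx hz
      | coe y =>
        have hxy' : x - y ≠ 0 := sub_ne_zero.2 (fun h => hxy (congrArg _ h))
        induction z using OnePoint.rec with
        | infty => exact two x y (fun h => hxy (congrArg _ h)) (hinf hz) hx hy
        | coe z =>
          refine two x y (fun h => hxy (congrArg _ h)) ?_ hx hy
          have hxz' : x - z ≠ 0 := sub_ne_zero.2 (fun h => hxz (congrArg _ h))
          have hyz' : y - z ≠ 0 := sub_ne_zero.2 (fun h => hyz (congrArg _ h))
          have h1 := hcoe x hx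
          have h2 := hcoe y hy
          have h3 := hcoe z hz
          refine (mul_eq_zero.1 (?_ : M 0 1 * ((x - y) * (x - z) * (y - z)) = 0)).resolve_right
            (mul_ne_zero (mul_ne_zero hxy' hxz') hyz')
          -- The Vandermonde combination that eliminates the constant and linear coefficients.
          linear_combination -(y - z) * h1 + (x - z) * h2 - (x - y) * h3
  obtain ⟨h1, h2, h3⟩ := main
  ext i j
  fin_cases i <;> fin_cases j
  · simp
  · simpa using h1
  · simpa using h3
  · simpa using (sub_eq_zero.1 h2).symm

/-- An element of `PSL₂(ℂ)` is determined by the images of three points. -/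
theorem eq_of_carries {g g' : PSL(2, ℂ)} {x y z x' y' z' : OnePoint ℂ} (hxy : x ≠ y)
    (hxz : x ≠ z) (hyz : y ≠ z) (hx : Carries g x x') (hy : Carries g y y') (hz : Carries g z z')
    (hx' : Carries g' x x') (hy' : Carries g' y y') (hz' : Carries g' z z') : g = g' := by
  have hSL : ∀ A : SL(2, ℂ), IsClassOf (A : GL (Fin 2) ℂ) (QuotientGroup.mk A) :=
    fun A => ⟨A, 1, rfl, by simp⟩
  obtain ⟨A, rfl⟩ := QuotientGroup.mk_surjective g
  obtain ⟨B, rfl⟩ := QuotientGroup.mk_surjective g'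
  rw [(hSL A).carries_iff] at hx hy hz
  rw [(hSL B).carries_iff] at hx' hy' hz'
  -- `B * A⁻¹` fixes the points on which `A` and `B` agree.
  have hfix : ∀ {u v : OnePoint ℂ},
      rightMobius ((A : GL (Fin 2) ℂ) : Matrix (Fin 2) (Fin 2) ℂ) u = v →
      rightMobius ((B : GL (Fin 2) ℂ) : Matrix (Fin 2) (Fin 2) ℂ) u = v →
      rightMobius (((B : GL (Fin 2) ℂ) * (A : GL (Fin 2) ℂ)⁻¹ : GL (Fin 2) ℂ) :
        Matrix (Fin 2) (Fin 2) ℂ) u = u := by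
    intro u v h h'
    rw [rightMobius_mul, h']
    exact rightMobius_inv _ h
  have h := scalar_of_fixed_points (GL.det_coe_ne_zero _) hxy hxz hyz (hfix hx hx') (hfix hy hy')
    (hfix hz hz')
  rw [mk_eq_mk_iff]
  generalize (((B : GL (Fin 2) ℂ) * (A : GL (Fin 2) ℂ)⁻¹ : GL (Fin 2) ℂ) :
        Matrix (Fin 2) (Fin 2) ℂ) 0 0 = c at h
  refine ⟨c, ?_⟩
  have h' := congrArg (· * ((A : GL (Fin 2) ℂ) : Matrix (Fin 2) (Fin 2) ℂ)) h
  simp only [← Units.val_mul, inv_mul_cancel_right, Matrix.smul_mul, one_mul] at h'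
  exact h'

end ProjectiveLine

/-! ### The braiding as matrix relations -/

namespace Braided

variable {χ₁ χ₂ χ₂' χ₁' : Shape} (h : Braided χ₁ χ₂ χ₂' χ₁')
include h

/-- The two entries are rescaled by inverse factors, which are nonzero because a₂' is. -/
theorem a_mul : χ₁'.a * χ₂'.a = χ₁.a * χ₂.a := by
  have h1 := h.a₁'
  have h2 := h.a₂'
  have := χ₂'.a_ne
  generalize (1 - χ₁.m * χ₁.b / χ₂.b * (1 - χ₁.a / χ₁.m) * (1 - 1 / (χ₂.m * χ₂.a))) = A at h1 h2
  have hA : A ≠ 0 := by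
    rintro rfl
    simp [h2] at this
  rw [h1, h2]
  field_simp

/-- This is the upper left entry of x₁⁻x₂⁺ = x₂'⁺x₁'⁻; `lower_mul` and `upper_mul` are the
off-diagonal entries. -/
theorem a₂'_eq : χ₂'.a = χ₂.a + (χ₁.a - χ₁.m) * χ₁.b * ((χ₂.a - 1 / χ₂.m) / χ₂.b) := by
  have := χ₂.a_ne
  have := χ₂.b_ne
  have := χ₂.m_ne
  have := χ₁.m_ne
  rw [h.a₂']
  field_simp
  ring

theorem b₂'_eq : χ₁.a * χ₂'.b = (χ₁.a - χ₁.m) * χ₁.b + χ₂.b := by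
  have := χ₁.a_ne
  have := χ₁.b_ne
  have := χ₁.m_ne
  rw [h.b₂']
  field_simp
  ring

/-- Clear denominators; the quantity inverted in the formula for b₁' is nonzero, since otherwise b₁'
would be 0. -/
theorem b₁'_eq : χ₁'.b * (χ₁.m * χ₁.b - χ₂.m * χ₂.a * (χ₁.m * χ₁.b - χ₂.b))
    = χ₂.m * χ₂.b * χ₁.b := by
  have h1 := h.b₁'
  have hb := χ₁'.b_ne
  have := χ₁.b_ne
  have := χ₁.m_ne
  have hD : χ₁.m * χ₁.b - χ₂.m * χ₂.a * (χ₁.m * χ₁.b - χ₂.b)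
      = χ₁.m * χ₁.b * (1 - χ₂.m * χ₂.a * (1 - χ₂.b / (χ₁.m * χ₁.b))) := by
    field_simp
  rw [hD]
  generalize (1 - χ₂.m * χ₂.a * (1 - χ₂.b / (χ₁.m * χ₁.b))) = A at h1
  have hA : A ≠ 0 := by
    rintro rfl
    exact hb (by rw [h1, _root_.inv_zero, mul_zero])
  rw [h1]
  field_simp

theorem lower_mul : (χ₂'.a - 1 / χ₂'.m) / χ₂'.b = χ₁.a * ((χ₂.a - 1 / χ₂.m) / χ₂.b) := by
  have h1 := h.a₂'_eq
  have h2 := h.b₂'_eq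
  have := χ₂'.b_ne
  have h3 : (χ₂.a - 1 / χ₂.m) / χ₂.b * χ₂.b = χ₂.a - 1 / χ₂.m := div_mul_cancel₀ _ χ₂.b_ne
  rw [h.m₂', div_eq_iff this]
  linear_combination h1 - (χ₂.a - 1 / χ₂.m) / χ₂.b * h2 - h3

theorem upper_mul : χ₂'.a * ((χ₁'.a - χ₁'.m) * χ₁'.b) = (χ₁.a - χ₁.m) * χ₁.b := by
  have h1 := h.a₂'_eq
  have h2 := h.b₁'_eq
  have h3 := h.a_mul
  have h4 : χ₂.m * ((χ₂.a - 1 / χ₂.m) / χ₂.b * χ₂.b) = χ₂.m * χ₂.a - 1 := by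
    have := χ₂.m_ne
    have := χ₂.b_ne
    field_simp
  -- By `b₁'_eq` this factor divides a nonzero number. Multiplying the goal by it eliminates b₁'.
  have hr : χ₁.m * χ₁.b - χ₂.m * χ₂.a * (χ₁.m * χ₁.b - χ₂.b) ≠ 0 := by
    intro h0
    rw [h0, mul_zero] at h2
    exact mul_ne_zero (mul_ne_zero χ₂.m_ne χ₂.b_ne) χ₁.b_ne h2.symm
  generalize (χ₂.a - 1 / χ₂.m) / χ₂.b = c at h1 h4
  refine mul_right_cancel₀ hr ?_
  rw [h.m₁']
  linear_combination (χ₂'.a * (χ₁'.a - χ₁.m)) * h2 + χ₂.m * χ₂.b * χ₁.b * h3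
    - χ₁.m * χ₂.m * χ₂.b * χ₁.b * h1 - χ₁.m * χ₁.b * χ₁.b * (χ₁.a - χ₁.m) * h4

/-- The reciprocal of b₁' is what the matrix x₁'⁺ and the positions −1/b involve. -/
theorem inv_b₁' : 1 / χ₁'.b = χ₂.a / χ₁.b - χ₁.m * ((χ₂.a - 1 / χ₂.m) / χ₂.b) := by
  have h1 := h.b₁'_eq
  have := χ₁.b_ne
  have := χ₂.b_ne
  have := χ₂.m_ne
  have := χ₁'.b_ne
  field_simp
  linear_combination -h1

/-- The relation between passages above both strands. -/
theorem matrix_above : χ₁.matrix true * χ₂.matrix true = χ₂'.matrix true * χ₁'.matrix true := by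
  have h1 := h.lower_mul
  have h2 := h.a_mul
  have h3 := h.a₂'_eq
  have h4 := h.inv_b₁'
  have : (χ₁.a - 1 / χ₁.m) / χ₁.b * χ₂.a + (χ₂.a - 1 / χ₂.m) / χ₂.b
      = (χ₂'.a - 1 / χ₂'.m) / χ₂'.b * χ₁'.a + (χ₁'.a - 1 / χ₁'.m) / χ₁'.b := by
    have h5 : 1 / χ₁.b * χ₁.b = 1 := one_div_mul_cancel χ₁.b_ne
    have h6 : 1 / χ₁.m * χ₁.m = 1 := one_div_mul_cancel χ₁.m_ne
    -- The factor a₂' brings in the product a₁'a₂', which `a_mul` replaces by a₁a₂.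
    refine mul_left_cancel₀ χ₂'.a_ne ?_
    rw [h1, h.m₁', ← mul_one_div (χ₁'.a - 1 / χ₁.m), h4, ← mul_one_div χ₂.a χ₁.b,
      ← mul_one_div _ χ₁.b]
    generalize (χ₂.a - 1 / χ₂.m) / χ₂.b = d at h3
    generalize 1 / χ₁.b = u at h5
    generalize 1 / χ₁.m = v at h6
    linear_combination -(χ₁.a * d + χ₂.a * u - χ₁.m * d) * h2 + χ₁.a * χ₂.a * u * h3
      + χ₁.a * χ₂.a * (χ₁.a - χ₁.m) * d * h5 - χ₂'.a * d * h6
  simp only [Shape.matrix, Matrix.mul_fin_two]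
  ext i j
  fin_cases i <;> fin_cases j <;> simp
  · linear_combination -h2
  · simpa using this

/-- The relation between passages below both strands. -/
theorem matrix_below :
    χ₁.matrix false * χ₂.matrix false = χ₂'.matrix false * χ₁'.matrix false := by
  have h1 := h.upper_mul
  have h2 := h.a_mul
  have h3 := h.a₂'_eq
  have h4 := h.b₂'_eq
  have : (χ₂.a - χ₂.m) * χ₂.b + (χ₁.a - χ₁.m) * χ₁.b * χ₂.a
      = (χ₁'.a - χ₁'.m) * χ₁'.b + (χ₂'.a - χ₂'.m) * χ₂'.b * χ₁'.a := by
    have h5 : χ₂.m * ((χ₂.a - 1 / χ₂.m) / χ₂.b * χ₂.b) = χ₂.m * χ₂.a - 1 := by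
      have := χ₂.m_ne
      have := χ₂.b_ne
      field_simp
    refine mul_left_cancel₀ χ₂'.a_ne ?_
    rw [h.m₂']
    linear_combination -h1 - (χ₂'.a - χ₂.m) * χ₂'.b * h2 - (χ₂'.a - χ₂.m) * χ₂.a * h4
      - χ₂.m * χ₂.b * h3 - (χ₁.a - χ₁.m) * χ₁.b * h5
  simp only [Shape.matrix, Matrix.mul_fin_two]
  ext i j
  fin_cases i <;> fin_cases j <;> simp
  · linear_combination this
  · linear_combination -h2

/-- The relation between passages between the two strands. -/
theorem matrix_between :
    χ₁.matrix false * χ₂.matrix true = χ₂'.matrix true * χ₁'.matrix false := by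
  have h1 := h.lower_mul
  have h2 := h.upper_mul
  have h3 := h.a₂'_eq
  have h4 := h.a_mul
  have h5 : χ₁.a = (χ₂'.a - 1 / χ₂'.m) / χ₂'.b * ((χ₁'.a - χ₁'.m) * χ₁'.b) + χ₁'.a := by
    refine mul_left_cancel₀ χ₂'.a_ne ?_
    rw [h1]
    linear_combination χ₁.a * h3 - χ₁.a * ((χ₂.a - 1 / χ₂.m) / χ₂.b) * h2 - h4
  simp only [Shape.matrix, Matrix.mul_fin_two]
  ext i j
  fin_cases i <;> fin_cases j <;> simp
  · linear_combination -h3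
  · linear_combination -h2
  · simpa using h1.symm
  · simpa using h5

end Braided

/-! ### The action of the matrices on the positions of vertices -/

theorem rightMobius_coe {M : Matrix (Fin 2) (Fin 2) ℂ} {z w : ℂ} (h : M 0 1 * z + M 1 1 ≠ 0)
    (h' : M 0 0 * z + M 1 0 = w * (M 0 1 * z + M 1 1)) :
    rightMobius M (z : OnePoint ℂ) = (w : OnePoint ℂ) := by
  change (if M 0 1 * z + M 1 1 = 0 then OnePoint.infty else
    (((M 0 0 * z + M 1 0) / (M 0 1 * z + M 1 1) : ℂ) : OnePoint ℂ)) = _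
  rw [if_neg h, h', mul_div_cancel_right₀ _ h]

theorem rightMobius_one (z : OnePoint ℂ) :
    rightMobius (1 : Matrix (Fin 2) (Fin 2) ℂ) z = z :=
  (rightMobius_eq_iff (by simp) z z).2 ⟨1, one_ne_zero, by simp⟩

namespace Shape

variable (χ : Shape)

theorem det_matrix (ε : Bool) : (χ.matrix ε).det ≠ 0 := by
  cases ε <;> simp [matrix, χ.a_ne]

/-- The matrices `x⁺`, `x⁻` as elements of `GL₂(ℂ)`. -/
noncomputable def gl (ε : Bool) : GL (Fin 2) ℂ :=
  Matrix.GeneralLinearGroup.mkOfDetNeZero (χ.matrix ε) (χ.det_matrix ε)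

/-- This concerns the vertex on the strand being passed: x⁺ and x⁻ both move it from its position on
the left of the segment to that on the right. -/
theorem rightMobius_strand (ε : Bool) {m : ℂ} (hm : m = χ.m) :
    rightMobius (χ.matrix ε) ((-1 / χ.b : ℂ) : OnePoint ℂ)
      = ((-1 / (m * χ.b) : ℂ) : OnePoint ℂ) := by
  subst hm
  have hb := χ.b_ne
  have hm := χ.m_ne
  cases ε
  · have h : (χ.a - χ.m) * χ.b * (-1 / χ.b) + χ.a = χ.m := by
      field_simp
      ring
    refine rightMobius_coe ?_ ?_ <;>
      simp only [matrix, Matrix.of_apply, Matrix.cons_val', Matrix.cons_val_zero,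
        Matrix.cons_val_one, Matrix.cons_val_fin_one] <;> rw [h]
    · exact hm
    · field_simp
      ring
  · refine rightMobius_coe ?_ ?_
    · simp [matrix]
    · simp only [matrix, Matrix.of_apply, Matrix.cons_val', Matrix.cons_val_zero,
        Matrix.cons_val_one, Matrix.cons_val_fin_one]
      field_simp
      ring

theorem rightMobius_infty : rightMobius (χ.matrix true) OnePoint.infty = OnePoint.infty :=
  if_pos rfl

theorem rightMobius_zero :
    rightMobius (χ.matrix false) ((0 : ℂ) : OnePoint ℂ) = ((0 : ℂ) : OnePoint ℂ) :=
  rightMobius_coe (by simp [matrix, χ.a_ne]) (by simp [matrix])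

end Shape

namespace Braided

variable {χ₁ χ₂ χ₂' χ₁' : Shape} (h : Braided χ₁ χ₂ χ₂' χ₁')
include h

/-- At a positive crossing, passing above strand two moves the vertex on strand one: here from W to
S, in `rightMobius_above_out` from N to E. The free `m` serves negative crossings, where the
positions use the m of the other end of the strand. -/
theorem rightMobius_above_in {m : ℂ} (hm : m = χ₁.m) :
    rightMobius (χ₂.matrix true) ((-1 / (m * χ₁.b) : ℂ) : OnePoint ℂ)
      = ((-1 / (m * χ₁'.b) : ℂ) : OnePoint ℂ) := by
  subst hm
  have h1 := h.inv_b₁'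
  have := χ₁.m_ne
  refine rightMobius_coe (by simp [Shape.matrix]) ?_
  simp only [Shape.matrix, Matrix.of_apply, Matrix.cons_val', Matrix.cons_val_zero,
    Matrix.cons_val_one, Matrix.cons_val_fin_one]
  have h2 : -1 / (χ₁.m * χ₁'.b) = -(1 / χ₁'.b) / χ₁.m := by
    field_simp
  rw [h2, h1]
  field_simp
  ring

theorem rightMobius_above_out :
    rightMobius (χ₂'.matrix true) ((-1 / χ₁.b : ℂ) : OnePoint ℂ)
      = ((-1 / χ₁'.b : ℂ) : OnePoint ℂ) := by
  have h1 := h.inv_b₁'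
  have h2 := h.lower_mul
  have h3 := h.a₂'_eq
  have := χ₁.b_ne
  refine rightMobius_coe (by simp [Shape.matrix]) ?_
  simp only [Shape.matrix, Matrix.of_apply, Matrix.cons_val', Matrix.cons_val_zero,
    Matrix.cons_val_one, Matrix.cons_val_fin_one]
  rw [neg_div χ₁'.b 1, h1, h2, h3]
  generalize (χ₂.a - 1 / χ₂.m) / χ₂.b = d
  field_simp
  ring

/-- At a positive crossing, passing below strand one moves the vertex on strand two: here from N to
W, by the formula for b₂', and in `rightMobius_below_out` from E to S. -/
theorem rightMobius_below_in :
    rightMobius (χ₁.matrix false) ((-1 / χ₂'.b : ℂ) : OnePoint ℂ)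
      = ((-1 / χ₂.b : ℂ) : OnePoint ℂ) := by
  have h1 := h.b₂'_eq
  have hb := χ₂'.b_ne
  have hb' := χ₂.b_ne
  have h2 : (χ₁.a - χ₁.m) * χ₁.b * (-1 / χ₂'.b) + χ₁.a = χ₂.b / χ₂'.b := by
    field_simp
    linear_combination h1
  refine rightMobius_coe ?_ ?_ <;>
    simp only [Shape.matrix, Matrix.of_apply, Matrix.cons_val', Matrix.cons_val_zero,
      Matrix.cons_val_one, Matrix.cons_val_fin_one] <;> rw [h2]
  · exact div_ne_zero hb' hb
  · field_simp
    ring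

theorem rightMobius_below_out {m : ℂ} (hm : m = χ₂.m) :
    rightMobius (χ₁'.matrix false) ((-1 / (m * χ₂'.b) : ℂ) : OnePoint ℂ)
      = ((-1 / (m * χ₂.b) : ℂ) : OnePoint ℂ) := by
  subst hm
  have h1 := h.b₂'_eq
  have hb := χ₂'.b_ne
  have hb' := χ₂.b_ne
  have hm := χ₂.m_ne
  have h2 : χ₁'.a * (χ₂.m * χ₂'.b) - (χ₁'.a - χ₁'.m) * χ₁'.b = χ₂.m * χ₂.b := by
    have h3 := h.upper_mul
    have h4 := h.a_mul
    have h5 := h.a₂'_eq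
    have h6 : χ₂.m * ((χ₂.a - 1 / χ₂.m) / χ₂.b * χ₂.b) = χ₂.m * χ₂.a - 1 := by
      field_simp
    refine mul_left_cancel₀ χ₂'.a_ne ?_
    linear_combination χ₂.m * χ₂'.b * h4 - h3 + χ₂.a * χ₂.m * h1 - χ₂.m * χ₂.b * h5
      - (χ₁.a - χ₁.m) * χ₁.b * h6
  have h3 : (χ₁'.a - χ₁'.m) * χ₁'.b * (-1 / (χ₂.m * χ₂'.b)) + χ₁'.a = χ₂.b / χ₂'.b := by
    field_simp
    linear_combination h2
  refine rightMobius_coe ?_ ?_ <;>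
    simp only [Shape.matrix, Matrix.of_apply, Matrix.cons_val', Matrix.cons_val_zero,
      Matrix.cons_val_one, Matrix.cons_val_fin_one] <;> rw [h3]
  · exact div_ne_zero hb' hb
  · field_simp
    ring

end Braided

/-! ### Face maps and the algebraic holonomy -/

namespace Shaping

variable {D : LinkDiagram} (χ : Shaping D)

/-- The matrices of a shaping satisfy the relations of the fundamental groupoid. -/
theorem relations : LinkDiagram.Relations (fun s ε => (χ.shape s).gl ε) where
  same c ε := by
    refine Units.ext ?_
    cases hc : D.positive c
    · have h := χ.negative_crossing c hc
      cases ε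
      · exact h.matrix_below.symm
      · exact h.matrix_above.symm
    · have h := χ.positive_crossing c hc
      cases ε
      · exact h.matrix_below
      · exact h.matrix_above
  between_pos c hc := Units.ext (χ.positive_crossing c hc).matrix_between
  between_neg c hc := Units.ext (χ.negative_crossing c hc).matrix_between.symm

theorem pos_minus (t : D.Corner) : χ.pos t .minus = ((0 : ℂ) : OnePoint ℂ) := by
  obtain ⟨c, K⟩ := t
  cases K <;> rfl

theorem pos_plus (t : D.Corner) : χ.pos t .plus = OnePoint.infty := by
  obtain ⟨c, K⟩ := t
  cases K <;> rfl

theorem m_tail (c : D.Crossing) (k : Strand) :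
    (χ.shape (D.tail.symm (c, k))).m = (χ.shape (D.head.symm (c, k))).m := by
  cases hc : D.positive c
  · have h := χ.negative_crossing c hc
    cases k
    · exact h.m₂'.symm
    · exact h.m₁'.symm
  · have h := χ.positive_crossing c hc
    cases k
    · exact h.m₁'
    · exact h.m₂'

/-- The position of the vertex on a strand depends only on the segment of that strand and on the
side on which the corner lies. -/
theorem pos_strand (t : D.Corner) (k : Strand) :
    χ.pos t (.strand k) = if t.side.isLeft k then ((-1 / (χ.shape (t.segment k)).b : ℂ) : OnePoint ℂ)
      else ((-1 / ((χ.shape (t.segment k)).m * (χ.shape (t.segment k)).b) : ℂ) : OnePoint ℂ) := by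
  obtain ⟨c, K⟩ := t
  cases k <;> cases K
  · rfl
  · rfl
  · change _ = ((-1 / ((χ.shape (D.tail.symm (c, .one))).m * _ : ℂ) : ℂ) : OnePoint ℂ)
    rw [m_tail]
    rfl
  · rfl
  · rfl
  · rfl
  · rfl
  · change _ = ((-1 / ((χ.shape (D.tail.symm (c, .two))).m * _ : ℂ) : ℂ) : OnePoint ℂ)
    rw [m_tail]
    rfl

/-- Hence the identity is a face map for every passage within a region. -/
theorem pos_along (t : D.Corner) (k : Strand) :
    χ.pos (t.along k) (.strand (t.alongStrand k)) = χ.pos t (.strand k) := by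
  rw [pos_strand, pos_strand, CrossingGraph.Corner.segment_along,
    CrossingGraph.Corner.isLeft_along]

/-- Passing a segment from left to right carries the positions of the vertices of the common face
of two tetrahedra to each other. -/
theorem rightMobius_pos_of_isLeft (t : D.Corner) (ε : Bool)
    (ht : t.side.isLeft (D.passStrand t.crossing ε) = true) (w : IdealVertex) (hw : w ≠ .pass ε) :
    rightMobius ((χ.shape (t.segment (D.passStrand t.crossing ε))).matrix ε) (χ.pos t w)
      = χ.pos (t.across (D.passStrand t.crossing ε)) w := by
  obtain ⟨c, K⟩ := t
  rcases w with l | _ | _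
  · obtain rfl | hl := eq_or_ne l (D.passStrand c ε)
    · rw [pos_strand, pos_strand, CrossingGraph.Corner.segment_across,
        CrossingGraph.Corner.isLeft_across, ht]
      exact (χ.shape _).rightMobius_strand ε rfl
    -- The vertex on the other strand is moved by the braiding. At a negative crossing the braiding
    -- is read backwards and the strands exchange roles.
    · have h1 : ∀ k, (χ.shape (D.head.symm (c, k))).m = (χ.shape (D.tail.symm (c, k))).m :=
        fun k => (χ.m_tail c k).symm
      revert hl
      change K.isLeft (D.passStrand c ε) = true at ht
      change _ → rightMobius ((χ.shape (CrossingGraph.Corner.segment ⟨c, K⟩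
        (D.passStrand c ε))).matrix ε) _ = χ.pos (CrossingGraph.Corner.across ⟨c, K⟩
          (D.passStrand c ε)) _
      cases hc : D.positive c
      · have h := χ.negative_crossing c hc
        have h2 : D.passStrand c false = .two := by
          simp [LinkDiagram.passStrand, CrossingGraph.overStrand, hc]
        have h3 : D.passStrand c true = .one := by
          simp [LinkDiagram.passStrand, CrossingGraph.underStrand, CrossingGraph.overStrand, hc,
            Strand.other]
        cases ε
        · rw [h2] at ht ⊢
          intro hl
          cases l <;> cases K <;> first
            | exact absurd rfl hl
            | exact absurd ht (by decide)
            | exact h.rightMobius_below_in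
            | exact h.rightMobius_below_out (h1 _)
        · rw [h3] at ht ⊢
          intro hl
          cases l <;> cases K <;> first
            | exact absurd rfl hl
            | exact absurd ht (by decide)
            | exact h.rightMobius_above_out
            | exact h.rightMobius_above_in (h1 _)
      · have h := χ.positive_crossing c hc
        have h2 : D.passStrand c false = .one := by
          simp [LinkDiagram.passStrand, CrossingGraph.overStrand, hc]
        have h3 : D.passStrand c true = .two := by
          simp [LinkDiagram.passStrand, CrossingGraph.underStrand, CrossingGraph.overStrand, hc,
            Strand.other]
        cases ε
        · rw [h2] at ht ⊢
          intro hl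
          cases l <;> cases K <;> first
            | exact absurd rfl hl
            | exact absurd ht (by decide)
            | exact h.rightMobius_below_in
            | exact h.rightMobius_below_out rfl
        · rw [h3] at ht ⊢
          intro hl
          cases l <;> cases K <;> first
            | exact absurd rfl hl
            | exact absurd ht (by decide)
            | exact h.rightMobius_above_out
            | exact h.rightMobius_above_in rfl
  · cases ε
    · rw [pos_minus, pos_minus]
      exact Shape.rightMobius_zero _
    · exact absurd rfl hw
  · cases ε
    · exact absurd rfl hw
    · rw [pos_plus, pos_plus]
      exact Shape.rightMobius_infty _

/-- The algebraic holonomy of the passage through a face carries the positions of its vertices to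
those of the neighbouring tetrahedron. -/
theorem rightMobius_faceVal (t : D.Corner) (v w : IdealVertex) (hw : w ≠ v) :
    rightMobius ((LinkDiagram.faceVal (fun s ε => (χ.shape s).gl ε) t v : GL (Fin 2) ℂ) :
      Matrix (Fin 2) (Fin 2) ℂ) (χ.pos t w) = χ.pos (D.fourTermNbr t v) (D.fourTermPerm t v w) := by
  obtain ⟨k, rfl⟩ | ⟨ε, rfl⟩ := IdealVertex.strand_or_pass v
  · refine (rightMobius_one _).trans ?_
    change _ = χ.pos (t.along k.other) (strandPerm k.other (t.alongStrand k.other) w)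
    rcases w with l | _ | _
    · obtain rfl : l = k.other :=
        (Strand.eq_or_eq_other k l).resolve_left fun h => hw (congrArg _ h)
      rw [strandPerm_apply, pos_along]
    · have h : strandPerm k.other (t.alongStrand k.other) .minus = .minus :=
        LinkDiagram.strandPerm_pass _ _ true
      rw [h, pos_minus]
      exact (χ.pos_minus _).symm
    · have h : strandPerm k.other (t.alongStrand k.other) .plus = .plus :=
        LinkDiagram.strandPerm_pass _ _ false
      rw [h, pos_plus]
      exact (χ.pos_plus _).symm
  · rw [LinkDiagram.faceVal_pass, LinkDiagram.fourTermNbr_pass, LinkDiagram.fourTermPerm_pass,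
      Equiv.Perm.one_apply, LinkDiagram.crossVal]
    split
    · rename_i ht
      exact χ.rightMobius_pos_of_isLeft t ε ht w hw
    · rename_i ht
      -- A passage from right to left is inverse to the passage that starts on the other side of the
      -- segment.
      refine rightMobius_inv _ ?_
      have h := χ.rightMobius_pos_of_isLeft (t.across (D.passStrand t.crossing ε)) ε
        (by
          change (t.across (D.passStrand t.crossing ε)).side.isLeft (D.passStrand t.crossing ε) = _
          rw [CrossingGraph.Corner.isLeft_across]
          simpa using ht) w hw
      change rightMobius ((χ.shape ((t.across (D.passStrand t.crossing ε)).segment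
        (D.passStrand t.crossing ε))).matrix ε) _ = χ.pos ((t.across
          (D.passStrand t.crossing ε)).across (D.passStrand t.crossing ε)) w at h
      rwa [CrossingGraph.Corner.segment_across, CrossingGraph.Corner.across_across] at h

/-- The vertices of a tetrahedron at a crossing that is not pinched have distinct positions. -/
theorem pos_injective {t : D.Corner} (ht : ¬ χ.Pinched t.crossing) :
    Function.Injective (χ.pos t) := by
  have h0 : ∀ k, χ.pos t (.strand k) ≠ ((0 : ℂ) : OnePoint ℂ) := by
    intro k
    rw [pos_strand]
    split <;> rw [Ne, OnePoint.coe_eq_coe] <;>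
      simp [Shape.b_ne, Shape.m_ne]
  have hinf : ∀ k, χ.pos t (.strand k) ≠ OnePoint.infty := by
    intro k
    rw [pos_strand]
    split <;> exact OnePoint.coe_ne_infty _
  have h12 : χ.pos t (.strand .one) ≠ χ.pos t (.strand .two) := by
    obtain ⟨c, K⟩ := t
    simp only [Pinched, not_or] at ht
    obtain ⟨h1, h2, h3, h4⟩ := ht
    have key : ∀ {x y : ℂ}, x ≠ y → ((-1 / x : ℂ) : OnePoint ℂ) ≠ ((-1 / y : ℂ) : OnePoint ℂ) := by
      intro x y hxy h
      rw [OnePoint.coe_eq_coe, div_eq_mul_inv, div_eq_mul_inv] at h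
      exact hxy (inv_injective (mul_left_cancel₀ (by norm_num) h))
    -- Each clause of pinching is the coincidence of P₁ and P₂ at one corner: the third at N, the
    -- first at W, the second at S, the fourth at E.
    cases K
    · exact key (Ne.symm h3)
    · exact key (Ne.symm h1)
    · exact key (Ne.symm h2)
    · exact key (Ne.symm h4)
  have hz : χ.pos t .minus ≠ χ.pos t .plus := by
    rw [pos_minus, pos_plus]
    exact OnePoint.coe_ne_infty _
  have hm : ∀ k, χ.pos t (.strand k) ≠ χ.pos t .minus := fun k => by
    rw [pos_minus]
    exact h0 k
  have hp : ∀ k, χ.pos t (.strand k) ≠ χ.pos t .plus := fun k => by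
    rw [pos_plus]
    exact hinf k
  rintro (k | _ | _) (l | _ | _) h
  · cases k <;> cases l
    · rfl
    · exact absurd h h12
    · exact absurd h.symm h12
    · rfl
  · exact absurd h (hm k)
  · exact absurd h (hp k)
  · exact absurd h.symm (hm l)
  · rfl
  · exact absurd h hz
  · exact absurd h.symm (hp l)
  · exact absurd h.symm hz
  · rfl

theorem exists_three (v : IdealVertex) : ∃ x y z : IdealVertex,
    x ≠ v ∧ y ≠ v ∧ z ≠ v ∧ x ≠ y ∧ x ≠ z ∧ y ≠ z := by
  rcases v with (_ | _) | _ | _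
  · exact ⟨.strand .two, .minus, .plus, by decide⟩
  · exact ⟨.strand .one, .minus, .plus, by decide⟩
  · exact ⟨.strand .one, .strand .two, .plus, by decide⟩
  · exact ⟨.strand .one, .strand .two, .minus, by decide⟩

theorem IsFaceMap.unique {χ : Shaping D} {t : D.Corner} (ht : ¬ χ.Pinched t.crossing)
    {v : IdealVertex} {g g' : PSL(2, ℂ)} (h : χ.IsFaceMap t v g) (h' : χ.IsFaceMap t v g') :
    g = g' := by
  obtain ⟨x, y, z, hx, hy, hz, hxy, hxz, hyz⟩ := exists_three v
  have hi := χ.pos_injective ht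
  exact eq_of_carries (hi.ne hxy) (hi.ne hxz) (hi.ne hyz) (h x hx) (h y hy) (h z hz) (h' x hx)
    (h' y hy) (h' z hz)

/-- The algebraic holonomy. -/
noncomputable def holonomy : GroupoidRep D.PathGroupoid (GL (Fin 2) ℂ) :=
  LinkDiagram.pathRep _ χ.relations

theorem isHolonomy_holonomy : χ.IsHolonomy χ.holonomy := fun s ε =>
  congrArg (fun M : GL (Fin 2) ℂ => (M : Matrix (Fin 2) (Fin 2) ℂ))
    (LinkDiagram.pathRep_gen _ χ.relations ⟨s, ε, rfl, rfl⟩)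

end Shaping
theorem mainTheorem3 (D : LinkDiagram) (hD : D.OverAndUnder) (χ : Shaping D) :
    ∃ (Φ : D.fourTerm.FundGroupoid ⥤ D.PathGroupoid)
      (ρ : GroupoidRep D.PathGroupoid (GL (Fin 2) ℂ))
      (hol : GroupoidRep D.fourTerm.FundGroupoid PSL(2, ℂ)),
      CategoryTheory.Quotient.functor D.fourTerm.DualRel ⋙ Φ
          = Quiver.FreeGroupoid.lift D.comparison ∧
      Φ.IsEquivalence ∧
      χ.IsHolonomy ρ ∧
      (∀ (t : D.Corner) (v : IdealVertex), χ.IsFaceMap t v (hol.val (D.fourTerm.face t v))) ∧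
      (∀ (t : D.Corner) (v : IdealVertex), ¬ χ.Pinched t.crossing →
        ∀ g : PSL(2, ℂ), χ.IsFaceMap t v g → g = hol.val (D.fourTerm.face t v)) ∧
      (∀ (x y : D.fourTerm.FundGroupoid) (γ : x ⟶ y),
        IsClassOf (ρ.val (Φ.map γ)) (hol.val γ)) := by
  -- With hol defined as the class of ρ∘Φ, this is the geometric content; it holds at pinched
  -- crossings too, where face maps need not be unique.
  have hface : ∀ (t : D.Corner) (v : IdealVertex), χ.IsFaceMap t v
      (((χ.holonomy.comp hD.comparisonFunctor).push GL.toPSL).val (D.fourTerm.face t v)) := by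
    intro t v w hw
    change Carries (GL.toPSL _) _ _
    rw [toPSL_carries_iff]
    have h : (χ.holonomy.comp hD.comparisonFunctor).val (D.fourTerm.face t v)
        = LinkDiagram.faceVal (fun s ε => (χ.shape s).gl ε) t v := by
      refine (hD.comparisonFunctor_map_face χ.holonomy t v).trans ?_
      congr
      funext s ε
      exact LinkDiagram.pathRep_gen _ χ.relations ⟨s, ε, rfl, rfl⟩
    rw [h]
    exact χ.rightMobius_faceVal t v w hw
  exact ⟨hD.comparisonFunctor, χ.holonomy, (χ.holonomy.comp hD.comparisonFunctor).push GL.toPSL,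
    CategoryTheory.Quotient.lift_spec _ _ _, hD.comparisonFunctor_isEquivalence,
    χ.isHolonomy_holonomy, hface, fun t v ht g hg => hg.unique ht (hface t v),
    fun x y γ => GL.isClassOf_toPSL _⟩
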